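/- Elephant random walk (ERW) with $k$ extractions. Let $k\ge 1$ be odd and $p\in[0,1]$. The ERW with $k$ extractions is a sequence of steps $X_1,X_2,\dots\in\{+1,-1\}$ with averages $x_N=\frac1N\sum_{n\le N}X_n$, having an initial condition $x_M$ at some finite time $M\ge 1$ (the first $M$ steps have the given average $x_M$). For $N\ge M$, given $X_1,\dots,X_N$, one extracts $k$ of these steps uniformly at random, independently and with replacement. If the sum of the extracted steps is positive, then $X_{N+1}=+1$ with probability $p$ and $-1$ otherwise. If it is negative, then $X_{N+1}=-1$ with probability $p$ and $+1$ otherwise. For a function $\pi:[0,1]\to[0,1]$, a Hill–Lane–Sudderth (HLS) urn with urn function $\pi$ is a sequence $Y_1,Y_2,\dots\in\{0,1\}$ with densities $y_N=\frac1N\sum_{n\le N}Y_n$ and with an initial density $y_M$ at time $M$, such that for $N\ge M$, given $Y_1,\dots,Y_N$, one has $Y_{N+1}=1$ with probability $\pi(y_N)$ and $Y_{N+1}=0$ otherwise. A solution $y_0$ of $\pi(y)=y$ is a down-crossing (stable) if $\pi(y)>y$ just to the left and $\pi(y)<y$ just to the right of $y_0$. It is an up-crossing (unstable) if both inequalities are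 reversed. Put $P_k(y)=\sum_{k/2<h\le k}\binom{k}{h}y^h(1-y)^{k-h}$ and $\pi_k(y)=(1-p)+(2p-1)P_k(y)$. 1. For every odd $k$ and every $p\in[0,1]$, $\pi_k$ is a polynomial in $y$, of degree $k$ if $p\ne\frac12$, and if $(X_n)$ is the ERW with $k$ extractions and initial condition $x_M$, then $Y_n=(1+X_n)/2$ is an HLS urn with urn function $\pi_k$ and initial density $(1+x_M)/2$. 2. If $k=1$ and $0\le p<1$, or if $k=3$ and $0\le p<p_c=\frac56$, then $\frac12$ is the only solution of $\pi_k(y)=y$ in $[0,1]$, it is a down-crossing, and $x_N\to0$ almost surely, for every initial condition. 3. Let $k=3$ and $\frac56<p\le1$, and put $x_\pm(p)=\pm\sqrt{\frac{6p-5}{2p-1}}$, so that $x_-(p)<0<x_+(p)$. The solutions of $\pi_3(y)=y$ in $[0,1]$ are exactly $\frac12$, which is an up-crossing, and $y_\pm=\frac{1+x_\pm(p)}2$, which are down-crossings. For every initial condition, almost surely $x_N$ converges and $$\lim_{N\to\infty}x_N\in\{x_-(p),x_+(p)\}.$$ If moreover $p<1$, then for every initial condition both values are attained with positive probability. The limit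 depends on the initial condition: for every $\delta>0$ there are constants $c,C>0$, depending only on $p$ and $\delta$, such that for all $M\ge1$, $$P\big(\lim x_N=x_-(p)\big)\le Ce^{-cM}\ \text{ if } x_M\ge\delta,\qquad P\big(\lim x_N=x_+(p)\big)\le Ce^{-cM}\ \text{ if } x_M\le-\delta .$$ -/

import Mathlib

open MeasureTheory Filter Topology

universe u

noncomputable section

namespace ERW

/-- The average `(1/N) ∑_{n ≤ N} z_n` of the first `N` terms. Sequences are indexed from `0`, so that
`z i` is the entry made at time `i + 1`, and the entries up to time `N` are `z 0, …, z (N - 1)`. -/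
def avg (z : ℕ → ℝ) (N : ℕ) : ℝ := (∑ i ∈ Finset.range N, z i) / N

/-- The probability that the sum of `k` steps, extracted uniformly, independently and with
replacement from the `n` previous steps `h`, is positive: the proportion of the `n ^ k` possible
outcomes of the extraction for which this is so. -/
def probPosMajority (k : ℕ) {n : ℕ} (h : Fin n → ℝ) : ℝ :=
  (Nat.card {d : Fin k → Fin n // 0 < ∑ j, h (d j)} : ℝ) / (n : ℝ) ^ k

/-- The probability that the sum of the `k` extracted steps is negative. -/
def probNegMajority (k : ℕ) {n : ℕ} (h : Fin n → ℝ) : ℝ :=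
  (Nat.card {d : Fin k → Fin n // ∑ j, h (d j) < 0} : ℝ) / (n : ℝ) ^ k

/-- The probability that the elephant's next step is positive when the previous steps are `h`:
if the sum of the `k` extracted steps is positive, the next step is positive with probability `p`;
if it is negative, the next step is positive with probability `1 - p`. -/
def probUp (p : ℝ) (k : ℕ) {n : ℕ} (h : Fin n → ℝ) : ℝ :=
  p * probPosMajority k h + (1 - p) * probNegMajority k h

/-- `X` is an elephant random walk with memory parameter `p` and `k` extractions per step, with
initial condition `x_M = xM` at time `M`. After time `M` the conditional probability that
the next step is `+1`, given the previous steps, is `probUp`; otherwise the step is `-1`. -/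
structure IsERW (p : ℝ) (k M : ℕ) (xM : ℝ) {Ω : Type u} [MeasurableSpace Ω] (μ : Measure Ω)
    (X : ℕ → Ω → ℝ) : Prop where
  measurable : ∀ n, Measurable (X n)
  step_eq : ∀ n ω, X n ω = 1 ∨ X n ω = -1
  initial : ∀ᵐ ω ∂μ, avg (fun i => X i ω) M = xM
  transition : ∀ n, M ≤ n → ∀ h : Fin n → ℝ,
    μ.real {ω | (∀ i : Fin n, X i ω = h i) ∧ X n ω = 1} =
      μ.real {ω | ∀ i : Fin n, X i ω = h i} * probUp p k h

/-- `Y` is a Hill–Lane–Sudderth urn process with urn function `f`, with density of black balls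
`y_M = yM` at time `M`. The ball added at each later time is black (`1`) with conditional
probability `f y_n`, where `y_n` is the current density of black balls, and white (`0`)
otherwise. -/
structure IsHLSUrn (f : ℝ → ℝ) (M : ℕ) (yM : ℝ) {Ω : Type u} [MeasurableSpace Ω] (μ : Measure Ω)
    (Y : ℕ → Ω → ℝ) : Prop where
  urnFunction_mem : ∀ y ∈ Set.Icc (0 : ℝ) 1, f y ∈ Set.Icc (0 : ℝ) 1
  measurable : ∀ n, Measurable (Y n)
  ball_eq : ∀ n ω, Y n ω = 1 ∨ Y n ω = 0
  initial : ∀ᵐ ω ∂μ, avg (fun i => Y i ω) M = yM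
  transition : ∀ n, M ≤ n → ∀ h : Fin n → ℝ,
    μ.real {ω | (∀ i : Fin n, Y i ω = h i) ∧ Y n ω = 1} =
      μ.real {ω | ∀ i : Fin n, Y i ω = h i} * f ((∑ i, h i) / n)

/-- `P_k(y) = ∑_{k/2 < h ≤ k} (k choose h) y^h (1-y)^(k-h)`. -/
def majorityPoly (k : ℕ) (y : ℝ) : ℝ :=
  ∑ h ∈ Finset.Ioc (k / 2) k, (k.choose h : ℝ) * y ^ h * (1 - y) ^ (k - h)

/-- `π_k(y) = (1 - p) + (2p - 1) P_k(y)`. -/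
def urnFunction (p : ℝ) (k : ℕ) (y : ℝ) : ℝ := (1 - p) + (2 * p - 1) * majorityPoly k y

/-- `f` crosses the diagonal at `y₀` from top to bottom (a stable equilibrium). -/
def IsDownCrossing (f : ℝ → ℝ) (y₀ : ℝ) : Prop :=
  f y₀ = y₀ ∧ (∀ᶠ y in 𝓝[<] y₀, y < f y) ∧ (∀ᶠ y in 𝓝[>] y₀, f y < y)

/-- `f` crosses the diagonal at `y₀` from bottom to top (an unstable equilibrium). -/
def IsUpCrossing (f : ℝ → ℝ) (y₀ : ℝ) : Prop :=
  f y₀ = y₀ ∧ (∀ᶠ y in 𝓝[<] y₀, f y < y) ∧ (∀ᶠ y in 𝓝[>] y₀, y < f y)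

/-- `x₊(p)`. -/
def xPlus (p : ℝ) : ℝ := Real.sqrt ((6 * p - 5) / (2 * p - 1))

/-- `x₋(p)`. -/
def xMinus (p : ℝ) : ℝ := -Real.sqrt ((6 * p - 5) / (2 * p - 1))

/-- The event that `x_N → l`. -/
def limitEvent {Ω : Type u} (X : ℕ → Ω → ℝ) (l : ℝ) : Set Ω :=
  {ω | Tendsto (fun N => avg (fun i => X i ω) N) atTop (𝓝 l)}

end ERW

end

/-!
The transition law of the walk depends on the past only through the current average `x`: the
number of positive steps among `k` extractions is binomial, so for odd `k` the next step has mean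
`g x = stepMean p k x = 2 * urnFunction p k ((1 + x) / 2) - 1`. For `k = 1` and `k = 3` the function
`g` is an explicit odd polynomial. All further arguments are about sign processes whose next step
has conditional mean `g x` (`IsStepProcess`), a class that is closed under conditioning on the past
(`IsStepProcess.cond`) and, as `g` is odd, under reflection (`IsStepProcess.neg`).

*Convergence.* The averages satisfy `x_{n+1} = x_n + (g x_n - x_n) / (n + 1) + noise`, where the
accumulated noise is an `L²`-bounded martingale and hence converges almost surely. Off the zeros of
the drift `g x - x`, a level can be crossed only finitely often, so the averages converge, and since
the step sizes are not summable the limit is a zero of the drift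
(`exists_tendsto_zero_of_drift`, `IsStepProcess.ae_exists_tendsto_avg`). For `k = 1`, and for
`k = 3` below the critical value, the only zero is `0`.

*Instability of `0`.* Above the critical value the zeros are `0` and `±xPlus p`. The function
`-log (x² + 8 / n) + 24 * (8 / n) / (x² + 8 / n)` has nonpositive mean increments as long as the
average stays near `0`: the logarithm profits from the repulsive drift outside the scale
`n ^ (-1/2)`, and the bounded second term profits from the noise at that scale
(`mean_potential_succ_le`). On the event that the average tends to `0` this function tends to
infinity, while its mean, killed at the exit from a neighbourhood of `0`, stays bounded, so the
event is null (`IsStepProcess.measure_limitEvent_zero`).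

*Dependence on the initial condition.* For `0 < a < xPlus p` the mean of the next step exceeds `a`
by a fixed amount whenever the average is at least `a`. Hence `min 1 (exp (-r * ∑ (X_i - a)))` is a
supermartingale for small `r > 0`; it starts exponentially small in `M` when the initial average is
at least `δ > a`, and it is `1` whenever the average is below `a`
(`IsStepProcess.real_limitEvent_le`). For `p < 1` a long run of positive steps has positive
probability and brings the average above `1 / 2`; conditionally on it the limit `xMinus p` has
probability less than `1`, so the limit `xPlus p` has positive probability. The reflected
statements follow from the symmetry.
-/

namespace ERW

/-! ### The majority polynomial -/

/-- The majority polynomial as an element of `ℝ[X]`. -/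
noncomputable def majorityPolynomial (k : ℕ) : Polynomial ℝ :=
  ∑ h ∈ Finset.Ioc (k / 2) k,
    Polynomial.C (k.choose h : ℝ) * Polynomial.X ^ h * (1 - Polynomial.X) ^ (k - h)

lemma eval_majorityPolynomial (k : ℕ) (y : ℝ) :
    (majorityPolynomial k).eval y = majorityPoly k y := by
  simp [majorityPolynomial, majorityPoly, Polynomial.eval_finsetSum]

lemma natDegree_one_sub_X_le : (1 - Polynomial.X : Polynomial ℝ).natDegree ≤ 1 := by
  compute_degree

lemma natDegree_majorityPolynomial_le (k : ℕ) : (majorityPolynomial k).natDegree ≤ k := by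
  refine Polynomial.natDegree_sum_le_of_forall_le _ _ fun h hh => ?_
  have hk : h ≤ k := (Finset.mem_Ioc.1 hh).2
  refine Polynomial.natDegree_mul_le.trans ?_
  have h1 := Polynomial.natDegree_C_mul_X_pow_le (k.choose h : ℝ) h
  have h2 := Polynomial.natDegree_pow_le_of_le (k - h) natDegree_one_sub_X_le
  omega

/-- The leading coefficient is a partial alternating sum of binomial coefficients, hence itself a
binomial coefficient up to sign. -/
lemma coeff_majorityPolynomial (m : ℕ) :
    (majorityPolynomial (2 * m + 1)).coeff (2 * m + 1) = (-1) ^ m * ((2 * m).choose m : ℝ) := by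
  have key : ∀ h ∈ Finset.Ioc ((2 * m + 1) / 2) (2 * m + 1),
      (Polynomial.C ((2 * m + 1).choose h : ℝ) * Polynomial.X ^ h *
        (1 - Polynomial.X) ^ (2 * m + 1 - h)).coeff (2 * m + 1) =
      (-1) ^ (2 * m + 1 - h) * ((2 * m + 1).choose (2 * m + 1 - h) : ℝ) := by
    intro h hh
    have hk : h ≤ 2 * m + 1 := (Finset.mem_Ioc.1 hh).2
    have e := Polynomial.coeff_pow_of_natDegree_le (m := 2 * m + 1 - h) natDegree_one_sub_X_le
    rw [mul_one] at e
    have e2 : (2 * m + 1) = (2 * m + 1 - h) + h := by omega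
    rw [mul_assoc, Polynomial.coeff_C_mul, Polynomial.coeff_X_pow_mul', if_pos hk, e,
      Nat.choose_symm hk]
    simp [Polynomial.coeff_one, mul_comm]
  have halt := congrArg (Int.cast : ℤ → ℝ)
    (Int.alternating_sum_range_choose_eq_choose (n := 2 * m) (m := m))
  push_cast at halt
  rw [majorityPolynomial, Polynomial.finsetSum_coeff, Finset.sum_congr rfl key, ← halt]
  refine Finset.sum_nbij' (fun h => 2 * m + 1 - h) (fun j => 2 * m + 1 - j) ?_ ?_ ?_ ?_ ?_
  · intro a ha; simp only [Finset.mem_Ioc, Finset.mem_range] at *; omega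
  · intro a ha; simp only [Finset.mem_Ioc, Finset.mem_range] at *; omega
  · intro a ha; simp only [Finset.mem_Ioc] at *; omega
  · intro a ha; simp only [Finset.mem_range] at *; omega
  · intro a _; rfl

lemma exists_polynomial_eval_eq_urnFunction (p : ℝ) {k : ℕ} (hk : Odd k) :
    ∃ q : Polynomial ℝ, (∀ y, q.eval y = urnFunction p k y) ∧ (p ≠ 1 / 2 → q.natDegree = k) := by
  obtain ⟨m, rfl⟩ := hk
  refine ⟨Polynomial.C (1 - p) + Polynomial.C (2 * p - 1) * majorityPolynomial (2 * m + 1),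
    fun y => by simp [urnFunction, eval_majorityPolynomial], fun hp => ?_⟩
  have hp' : 2 * p - 1 ≠ 0 := fun h => hp (by linarith)
  apply Polynomial.natDegree_eq_of_le_of_coeff_ne_zero
  · refine Polynomial.natDegree_add_le_of_degree_le (by simp) ?_
    exact (Polynomial.natDegree_C_mul_le _ _).trans (natDegree_majorityPolynomial_le _)
  · rw [Polynomial.coeff_add, Polynomial.coeff_C_succ, Polynomial.coeff_C_mul,
      coeff_majorityPolynomial, zero_add]
    have : ((2 * m).choose m : ℝ) ≠ 0 := by
      exact_mod_cast (Nat.choose_pos (by omega : m ≤ 2 * m)).ne'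
    positivity

lemma majorityPoly_mem_Icc (k : ℕ) {y : ℝ} (hy : y ∈ Set.Icc (0 : ℝ) 1) :
    majorityPoly k y ∈ Set.Icc (0 : ℝ) 1 := by
  have hnn : ∀ h, 0 ≤ (k.choose h : ℝ) * y ^ h * (1 - y) ^ (k - h) := fun h =>
    mul_nonneg (mul_nonneg (Nat.cast_nonneg _) (pow_nonneg hy.1 _))
      (pow_nonneg (by linarith [hy.2]) _)
  refine ⟨Finset.sum_nonneg fun h _ => hnn h, ?_⟩
  calc majorityPoly k y
      ≤ ∑ h ∈ Finset.range (k + 1), (k.choose h : ℝ) * y ^ h * (1 - y) ^ (k - h) := by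
        refine Finset.sum_le_sum_of_subset_of_nonneg (fun a ha => ?_) fun h _ _ => hnn h
        simp only [Finset.mem_Ioc, Finset.mem_range] at *
        omega
    _ = (y + (1 - y)) ^ k := by
        rw [add_pow]
        exact Finset.sum_congr rfl fun h _ => by ring
    _ = 1 := by simp

lemma urnFunction_mem_Icc {p : ℝ} (h0 : 0 ≤ p) (h1 : p ≤ 1) (k : ℕ) {y : ℝ}
    (hy : y ∈ Set.Icc (0 : ℝ) 1) : urnFunction p k y ∈ Set.Icc (0 : ℝ) 1 := by
  have hP := majorityPoly_mem_Icc k hy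
  have e : urnFunction p k y = (1 - p) * (1 - majorityPoly k y) + p * majorityPoly k y := by
    simp only [urnFunction]; ring
  obtain ⟨ha, hb⟩ := hP
  rw [e]
  constructor <;> nlinarith

/-! ### Extracting steps from a history -/

/-- The number of extractions that draw a positive step exactly at the positions in `s`. -/
lemma card_extractions_eq_on {k n : ℕ} (U : Finset (Fin n)) (s : Finset (Fin k)) :
    (Finset.univ.filter fun d : Fin k → Fin n => (Finset.univ.filter fun j => d j ∈ U) = s).card =
      U.card ^ s.card * (n - U.card) ^ (k - s.card) := by
  classical
  have e : (Finset.univ.filter fun d : Fin k → Fin n =>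
      (Finset.univ.filter fun j => d j ∈ U) = s) =
      Fintype.piFinset fun j => if j ∈ s then U else Uᶜ := by
    ext d
    simp only [Finset.mem_filter, Finset.mem_univ, true_and, Fintype.mem_piFinset, Finset.ext_iff]
    refine forall_congr' fun j => ?_
    by_cases hj : j ∈ s <;> simp [hj]
  rw [e, Fintype.card_piFinset]
  simp only [apply_ite Finset.card]
  rw [Finset.prod_ite]
  simp [Finset.card_compl, Finset.filter_not, Finset.card_sdiff]

/-- A sum of `k` signs, of which those at `s` are positive. -/
lemma sum_signs {k n : ℕ} {h : Fin n → ℝ} (hh : ∀ i, h i = 1 ∨ h i = -1) (d : Fin k → Fin n) :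
    ∑ j, h (d j) =
      2 * ((Finset.univ.filter fun j => d j ∈ Finset.univ.filter fun i => h i = 1).card : ℝ) - k := by
  have e : ∀ j, h (d j) = 2 * (if h (d j) = 1 then 1 else 0) - 1 := by
    intro j
    rcases hh (d j) with h1 | h1 <;> rw [h1] <;> norm_num
  rw [Finset.sum_congr rfl fun j _ => e j, Finset.sum_sub_distrib, ← Finset.mul_sum]
  simp

lemma probPosMajority_eq {k n : ℕ} (hn : 1 ≤ n) {h : Fin n → ℝ}
    (hh : ∀ i, h i = 1 ∨ h i = -1) :
    probPosMajority k h = majorityPoly k ((1 + (∑ i, h i) / n) / 2) := by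
  classical
  set U : Finset (Fin n) := Finset.univ.filter fun i => h i = 1 with hU
  have hn' : (n : ℝ) ≠ 0 := by positivity
  have hUn : U.card ≤ n := by simpa using Finset.card_le_univ U
  have hy : (1 + (∑ i, h i) / n) / 2 = U.card / n := by
    have := sum_signs hh (id : Fin n → Fin n)
    simp only [id, Finset.filter_univ_mem] at this
    rw [this]
    field_simp
    ring
  have hiff : ∀ s : Finset (Fin k), (0 < 2 * (s.card : ℝ) - k) ↔ k / 2 < s.card := by
    intro s
    rw [sub_pos]
    constructor
    · intro h; have : k < 2 * s.card := by exact_mod_cast h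
      omega
    · intro h; have : k < 2 * s.card := by omega
      exact_mod_cast this
  have hcard : Nat.card {d : Fin k → Fin n // 0 < ∑ j, h (d j)} =
      ∑ m ∈ Finset.Ioc (k / 2) k, k.choose m * (U.card ^ m * (n - U.card) ^ (k - m)) := by
    rw [Nat.card_eq_fintype_card, Fintype.card_subtype]
    have hfib := Finset.card_eq_sum_card_fiberwise
      (s := Finset.univ.filter fun d : Fin k → Fin n => 0 < ∑ j, h (d j))
      (t := (Finset.univ : Finset (Finset (Fin k))))
      (f := fun d => Finset.univ.filter fun j => d j ∈ U) (fun _ _ => Finset.mem_univ _)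
    rw [hfib]
    have hs : ∀ s : Finset (Fin k),
        ((Finset.univ.filter fun d : Fin k → Fin n => 0 < ∑ j, h (d j)).filter
          fun d => (Finset.univ.filter fun j => d j ∈ U) = s).card =
        if k / 2 < s.card then U.card ^ s.card * (n - U.card) ^ (k - s.card) else 0 := by
      intro s
      rw [Finset.filter_filter]
      split_ifs with hlt
      · rw [← card_extractions_eq_on]
        congr 1
        ext d
        simp only [Finset.mem_filter, Finset.mem_univ, true_and, and_iff_right_iff_imp]
        intro hd
        rw [sum_signs hh d, ← hU, hd, hiff]
        exact hlt
      · rw [Finset.card_eq_zero, Finset.filter_eq_empty_iff]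
        rintro d - ⟨h1, h2⟩
        rw [sum_signs hh d, ← hU, h2, hiff] at h1
        exact hlt h1
    rw [Finset.sum_congr rfl fun s _ => hs s, ← Finset.powerset_univ,
      Finset.sum_powerset_apply_card
        (fun m => if k / 2 < m then U.card ^ m * (n - U.card) ^ (k - m) else 0),
      Finset.card_univ, Fintype.card_fin]
    have hsub : Finset.Ioc (k / 2) k ⊆ Finset.range (k + 1) := by
      intro a ha
      simp only [Finset.mem_Ioc, Finset.mem_range] at *
      omega
    rw [← Finset.sum_subset hsub]
    · refine Finset.sum_congr rfl fun m hm => ?_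
      rw [if_pos (Finset.mem_Ioc.1 hm).1, smul_eq_mul]
    · intro m hm hm'
      simp only [Finset.mem_Ioc, Finset.mem_range, not_and, not_le] at *
      rw [if_neg (fun hlt => by have := hm' hlt; omega), smul_zero]
  rw [probPosMajority, hcard, hy, majorityPoly]
  push_cast [Nat.cast_sub hUn]
  rw [Finset.sum_div]
  refine Finset.sum_congr rfl fun m hm => ?_
  have hmk : m ≤ k := (Finset.mem_Ioc.1 hm).2
  have e : (1 : ℝ) - U.card / n = (n - U.card) / n := by field_simp
  rw [e, div_pow, div_pow, mul_assoc, div_mul_div_comm, ← pow_add, Nat.add_sub_cancel' hmk,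
    mul_div_assoc]

/-- For an odd number of extractions there are no ties. -/
lemma probNegMajority_eq {k n : ℕ} (hk : Odd k) (hn : 1 ≤ n) {h : Fin n → ℝ}
    (hh : ∀ i, h i = 1 ∨ h i = -1) :
    probNegMajority k h = 1 - probPosMajority k h := by
  classical
  have hne : ∀ d : Fin k → Fin n, (∑ j, h (d j) < 0) ↔ ¬ (0 < ∑ j, h (d j)) := by
    intro d
    rw [not_lt]
    refine ⟨le_of_lt, fun hle => lt_of_le_of_ne hle fun h0 => ?_⟩
    rw [sum_signs hh d, sub_eq_zero] at h0
    have : 2 * (Finset.univ.filter fun j => d j ∈ Finset.univ.filter fun i => h i = 1).card = k := by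
      exact_mod_cast h0
    obtain ⟨m, hm⟩ := hk
    omega
  have hcard : (Nat.card {d : Fin k → Fin n // 0 < ∑ j, h (d j)} : ℝ) +
      Nat.card {d : Fin k → Fin n // ∑ j, h (d j) < 0} = (n : ℝ) ^ k := by
    have e := Finset.card_filter_add_card_filter_not
      (s := (Finset.univ : Finset (Fin k → Fin n))) (fun d => 0 < ∑ j, h (d j))
    simp only [← hne] at e
    rw [Nat.card_eq_fintype_card, Nat.card_eq_fintype_card, Fintype.card_subtype,
      Fintype.card_subtype]
    rw [Finset.card_univ, Fintype.card_fun, Fintype.card_fin, Fintype.card_fin] at e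
    exact_mod_cast e
  have hn' : (n : ℝ) ^ k ≠ 0 := by positivity
  rw [probPosMajority, probNegMajority, eq_sub_iff_add_eq, ← add_div, add_comm, hcard,
    div_self hn']

lemma probUp_eq_urnFunction (p : ℝ) {k n : ℕ} (hk : Odd k) (hn : 1 ≤ n) {h : Fin n → ℝ}
    (hh : ∀ i, h i = 1 ∨ h i = -1) :
    probUp p k h = urnFunction p k ((1 + (∑ i, h i) / n) / 2) := by
  rw [probUp, probNegMajority_eq hk hn hh, probPosMajority_eq hn hh, urnFunction]
  ring

/-! ### Processes of signs with a transition law depending on the average -/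

/-- `X` is a process of signs such that, from time `M` on, the conditional mean of the next sign
given the past is `g` of the current average. Unlike `IsERW` this does not prescribe the average
at time `M`. -/
structure IsStepProcess (g : ℝ → ℝ) (M : ℕ) {Ω : Type u} [MeasurableSpace Ω] (μ : Measure Ω)
    (X : ℕ → Ω → ℝ) : Prop where
  mean_mem : ∀ x ∈ Set.Icc (-1 : ℝ) 1, g x ∈ Set.Icc (-1 : ℝ) 1
  measurable : ∀ n, Measurable (X n)
  step_eq : ∀ n ω, X n ω = 1 ∨ X n ω = -1
  transition : ∀ n, M ≤ n → ∀ h : Fin n → ℝ,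
    μ.real {ω | (∀ i : Fin n, X i ω = h i) ∧ X n ω = 1} =
      μ.real {ω | ∀ i : Fin n, X i ω = h i} * ((1 + g ((∑ i, h i) / n)) / 2)

/-- The sequence that begins with `h` and continues with zeros. -/
def extend {n : ℕ} (h : Fin n → ℝ) (i : ℕ) : ℝ := if hi : i < n then h ⟨i, hi⟩ else 0

lemma dependsOn_avg {m n : ℕ} (h : m ≤ n) : DependsOn (fun z => avg z m) (Set.Iio n) := by
  intro x y hxy
  simp only [avg]
  rw [Finset.sum_congr rfl fun i hi => hxy i (lt_of_lt_of_le (Finset.mem_range.1 hi) h)]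

lemma avg_succ (z : ℕ → ℝ) (n : ℕ) : avg z (n + 1) = avg z n + (z n - avg z n) / (n + 1) := by
  rcases Nat.eq_zero_or_pos n with rfl | hn
  · simp [avg]
  · have : (n : ℝ) ≠ 0 := by positivity
    simp only [avg, Finset.sum_range_succ]
    push_cast
    field_simp
    ring

lemma avg_mem_Icc {z : ℕ → ℝ} (hz : ∀ i, z i = 1 ∨ z i = -1) (n : ℕ) :
    avg z n ∈ Set.Icc (-1 : ℝ) 1 := by
  rw [Set.mem_Icc, ← abs_le, avg, abs_div, Nat.abs_cast]
  refine div_le_one_of_le₀ ((Finset.abs_sum_le_sum_abs _ _).trans ?_) (Nat.cast_nonneg n)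
  have : ∀ i ∈ Finset.range n, |z i| = 1 := fun i _ => by rcases hz i with h | h <;> simp [h]
  rw [Finset.sum_congr rfl this]
  simp

namespace IsStepProcess

variable {g : ℝ → ℝ} {M : ℕ} {Ω : Type u} [MeasurableSpace Ω] {μ : Measure Ω} {X : ℕ → Ω → ℝ}

lemma avg_mem (hX : IsStepProcess g M μ X) (n : ℕ) (ω : Ω) :
    avg (X · ω) n ∈ Set.Icc (-1 : ℝ) 1 := avg_mem_Icc (fun i => hX.step_eq i ω) n

lemma mean_avg_mem (hX : IsStepProcess g M μ X) (n : ℕ) (ω : Ω) :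
    g (avg (X · ω) n) ∈ Set.Icc (-1 : ℝ) 1 := hX.mean_mem _ (hX.avg_mem n ω)

/-- The possible histories of `n` signs. -/
noncomputable def signs (n : ℕ) : Finset (Fin n → ℝ) := Fintype.piFinset fun _ => {1, -1}

lemma apply_eq_sum (hX : IsStepProcess g M μ X) {n : ℕ} {F : (ℕ → ℝ) → ℝ}
    (hF : DependsOn F (Set.Iio n)) (ω : Ω) :
    F (X · ω) = ∑ h ∈ signs n,
      Set.indicator {ω | ∀ i : Fin n, X i ω = h i} (fun _ => F (extend h)) ω := by
  rw [Finset.sum_eq_single_of_mem (fun i : Fin n => X i ω)]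
  · rw [Set.indicator_of_mem (by simp)]
    refine hF fun i hi => ?_
    rw [extend, dif_pos (show i < n from hi)]
  · simp only [signs, Fintype.mem_piFinset, Finset.mem_insert, Finset.mem_singleton]
    exact fun i => hX.step_eq i ω
  · intro h _ hne
    refine Set.indicator_of_notMem (fun hmem => hne ?_) _
    exact funext fun i => (hmem i).symm

/-- The filtration whose `n`-th term is generated by the first `n` signs. -/
def history (hX : IsStepProcess g M μ X) : Filtration ℕ ‹MeasurableSpace Ω› where
  seq n := MeasurableSpace.comap (fun ω (i : Fin n) => X i ω) inferInstance
  mono' := by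
    intro m n hmn
    have e : (fun ω (i : Fin m) => X i ω) =
        (fun (f : Fin n → ℝ) (i : Fin m) => f (Fin.castLE hmn i)) ∘ fun ω (i : Fin n) => X i ω :=
      rfl
    simp only
    rw [e, ← MeasurableSpace.comap_comp]
    exact MeasurableSpace.comap_mono (Measurable.comap_le
      (measurable_pi_lambda _ fun i => measurable_pi_apply _))
  le' n := Measurable.comap_le (measurable_pi_lambda _ fun i => hX.measurable i)

lemma measurable_history_apply (hX : IsStepProcess g M μ X) {n : ℕ} {F : (ℕ → ℝ) → ℝ}
    (hF : DependsOn F (Set.Iio n)) : Measurable[hX.history n] fun ω => F (X · ω) := by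
  simp only [hX.apply_eq_sum hF]
  refine Finset.measurable_sum _ fun h _ => Measurable.indicator measurable_const ?_
  refine ⟨{h}, measurableSet_singleton h, ?_⟩
  ext ω
  simp [funext_iff]

lemma measurable_apply (hX : IsStepProcess g M μ X) {n : ℕ} {F : (ℕ → ℝ) → ℝ}
    (hF : DependsOn F (Set.Iio n)) : Measurable fun ω => F (X · ω) :=
  (hX.measurable_history_apply hF).mono (hX.history.le n) le_rfl

lemma measurable_avg (hX : IsStepProcess g M μ X) (n : ℕ) : Measurable fun ω => avg (X · ω) n :=
  hX.measurable_apply (dependsOn_avg le_rfl)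

lemma exists_abs_le (hX : IsStepProcess g M μ X) {n : ℕ} {F : (ℕ → ℝ) → ℝ}
    (hF : DependsOn F (Set.Iio n)) : ∃ C, ∀ ω, |F (X · ω)| ≤ C := by
  refine ⟨∑ h ∈ signs n, |F (extend h)|, fun ω => ?_⟩
  rw [hX.apply_eq_sum hF]
  refine (Finset.abs_sum_le_sum_abs _ _).trans (Finset.sum_le_sum fun h _ => ?_)
  rw [← Real.norm_eq_abs]
  exact (norm_indicator_le_norm_self _ _)

lemma integrable_apply [IsProbabilityMeasure μ] (hX : IsStepProcess g M μ X) {n : ℕ}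
    {F : (ℕ → ℝ) → ℝ} (hF : DependsOn F (Set.Iio n)) : Integrable (fun ω => F (X · ω)) μ := by
  obtain ⟨C, hC⟩ := hX.exists_abs_le hF
  exact Integrable.of_bound (hX.measurable_apply hF).aestronglyMeasurable C
    (Eventually.of_forall hC)

lemma measurableSet_hist (hX : IsStepProcess g M μ X) {n : ℕ} (h : Fin n → ℝ) :
    MeasurableSet {ω | ∀ i : Fin n, X i ω = h i} := by
  simp only [Set.ofPred_forall]
  exact MeasurableSet.iInter fun i => hX.measurable i (measurableSet_singleton _)

lemma setIntegral_apply [IsProbabilityMeasure μ] (hX : IsStepProcess g M μ X) {n : ℕ}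
    {F : (ℕ → ℝ) → ℝ} (hF : DependsOn F (Set.Iio n)) (A : Set Ω) :
    ∫ ω in A, F (X · ω) ∂μ =
      ∑ h ∈ signs n, μ.real ({ω | ∀ i : Fin n, X i ω = h i} ∩ A) * F (extend h) := by
  simp only [hX.apply_eq_sum hF]
  rw [integral_finsetSum _ fun h _ =>
    (integrable_const _).indicator (hX.measurableSet_hist h)]
  refine Finset.sum_congr rfl fun h _ => ?_
  rw [integral_indicator (hX.measurableSet_hist h), setIntegral_const, smul_eq_mul,
    measureReal_restrict_apply (hX.measurableSet_hist h)]

lemma avg_extend {n : ℕ} (h : Fin n → ℝ) : avg (extend h) n = (∑ i, h i) / n := by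
  rw [avg, Finset.sum_range]
  simp [extend]

lemma dependsOn_next {n : ℕ} {F : (ℕ → ℝ) → ℝ → ℝ}
    (hF : ∀ t, DependsOn (fun z => F z t) (Set.Iio n)) :
    DependsOn (fun z => F z (z n)) (Set.Iio (n + 1)) := by
  intro x y hxy
  simp only
  rw [hxy n (Nat.lt_succ_self n)]
  exact hF _ fun i hi => hxy i (Nat.lt_succ_of_lt hi)

lemma dependsOn_mean {n : ℕ} (g : ℝ → ℝ) {F : (ℕ → ℝ) → ℝ → ℝ}
    (hF : ∀ t, DependsOn (fun z => F z t) (Set.Iio n)) :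
    DependsOn (fun z => (1 + g (avg z n)) / 2 * F z 1 + (1 - g (avg z n)) / 2 * F z (-1))
      (Set.Iio n) := by
  intro x y hxy
  have h1 := hF 1 hxy
  have h2 := hF (-1) hxy
  have h3 := dependsOn_avg le_rfl hxy
  simp only at *
  rw [h1, h2, h3]

/-- The transition law in integrated form: the next sign may be averaged out. -/
lemma integral_step [IsProbabilityMeasure μ] (hX : IsStepProcess g M μ X) {n : ℕ} (hn : M ≤ n)
    {F : (ℕ → ℝ) → ℝ → ℝ} (hF : ∀ t, DependsOn (fun z => F z t) (Set.Iio n)) :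
    ∫ ω, F (X · ω) (X n ω) ∂μ =
      ∫ ω, ((1 + g (avg (X · ω) n)) / 2 * F (X · ω) 1 +
        (1 - g (avg (X · ω) n)) / 2 * F (X · ω) (-1)) ∂μ := by
  set A : Set Ω := {ω | X n ω = 1} with hAdef
  have hA : MeasurableSet A := hX.measurable n (measurableSet_singleton 1)
  have hpos : ∫ ω in A, F (X · ω) (X n ω) ∂μ = ∫ ω in A, F (X · ω) 1 ∂μ :=
    setIntegral_congr_fun hA fun ω hω => by
      have : X n ω = 1 := hω
      simp only [this]
  have hneg : ∫ ω in Aᶜ, F (X · ω) (X n ω) ∂μ = ∫ ω in Aᶜ, F (X · ω) (-1) ∂μ :=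
    setIntegral_congr_fun hA.compl fun ω hω => by
      have : X n ω = -1 := (hX.step_eq n ω).resolve_left hω
      simp only [this]
  rw [← integral_add_compl hA (hX.integrable_apply (dependsOn_next hF)), hpos, hneg,
    hX.setIntegral_apply (hF 1), hX.setIntegral_apply (hF (-1)), ← Finset.sum_add_distrib,
    ← setIntegral_univ, hX.setIntegral_apply (dependsOn_mean g hF)]
  refine Finset.sum_congr rfl fun h _ => ?_
  have htr : μ.real ({ω | ∀ i : Fin n, X i ω = h i} ∩ A) = _ := hX.transition n hn h
  have hsplit := measureReal_inter_add_sdiff (μ := μ) (s := {ω | ∀ i : Fin n, X i ω = h i}) hA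
  rw [Set.inter_univ, avg_extend]
  rw [Set.sdiff_eq] at hsplit
  rw [eq_sub_of_add_eq' hsplit, htr]
  ring

/-- The increments `X n - g (avg X n)` are orthogonal to the past. -/
lemma integral_mul_sub_mean [IsProbabilityMeasure μ] (hX : IsStepProcess g M μ X) {n : ℕ}
    (hn : M ≤ n) {F : (ℕ → ℝ) → ℝ} (hF : DependsOn F (Set.Iio n)) :
    ∫ ω, F (X · ω) * (X n ω - g (avg (X · ω) n)) ∂μ = 0 := by
  have hdep : ∀ t, DependsOn (fun z => F z * (t - g (avg z n))) (Set.Iio n) := by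
    intro t x y hxy
    simp only
    rw [hF hxy, show avg x n = avg y n from dependsOn_avg le_rfl hxy]
  rw [hX.integral_step hn (F := fun z t => F z * (t - g (avg z n))) hdep]
  rw [← integral_zero Ω ℝ (μ := μ)]
  congr 1
  ext ω
  ring

lemma neg (hX : IsStepProcess g M μ X) (hodd : ∀ x, g (-x) = -g x) [IsProbabilityMeasure μ] :
    IsStepProcess g M μ (fun n ω => -X n ω) where
  mean_mem := hX.mean_mem
  measurable n := (hX.measurable n).neg
  step_eq n ω := by rcases hX.step_eq n ω with h | h <;> simp [h]
  transition n hn h := by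
    have hA : MeasurableSet {ω | X n ω = 1} := hX.measurable n (measurableSet_singleton 1)
    have e1 : {ω | ∀ i : Fin n, -X i ω = h i} = {ω | ∀ i : Fin n, X i ω = (-h) i} := by
      ext ω; simp [neg_eq_iff_eq_neg]
    have e2 : {ω | (∀ i : Fin n, -X i ω = h i) ∧ -X n ω = 1} =
        {ω | ∀ i : Fin n, X i ω = (-h) i} \ {ω | X n ω = 1} := by
      rw [← e1]
      ext ω
      simp only [Set.mem_ofPred_eq, Set.mem_sdiff]
      refine and_congr_right fun _ => ?_
      rcases hX.step_eq n ω with h | h <;> rw [h] <;> norm_num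
    have htr : μ.real ({ω | ∀ i : Fin n, X i ω = (-h) i} ∩ {ω | X n ω = 1}) = _ :=
      hX.transition n hn (-h)
    have hsplit := measureReal_inter_add_sdiff (μ := μ) (s := {ω | ∀ i : Fin n, X i ω = (-h) i}) hA
    have e3 : (∑ i, (-h) i) / (n : ℝ) = -((∑ i, h i) / n) := by
      simp [neg_div]
    rw [e3, hodd] at htr
    rw [e1, e2, eq_sub_of_add_eq' hsplit, htr]
    ring

/-- Conditioning on an event of the first `N` signs leaves the transition law after `N` as it
is. -/
lemma cond (hX : IsStepProcess g M μ X) [IsProbabilityMeasure μ] {N : ℕ} (hN : M ≤ N)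
    {E : Set (ℕ → ℝ)} (hE : DependsOn (· ∈ E) (Set.Iio N)) :
    IsStepProcess g N (ProbabilityTheory.cond μ {ω | (X · ω) ∈ E}) X where
  mean_mem := hX.mean_mem
  measurable := hX.measurable
  step_eq := hX.step_eq
  transition n hn h := by
    classical
    have hEm : MeasurableSet {ω | (X · ω) ∈ E} := by
      have hd : DependsOn (fun z => if z ∈ E then (1 : ℝ) else 0) (Set.Iio N) := by
        intro x y hxy
        have := hE hxy
        simp only at *
        simp only [this]
      convert hX.measurable_apply hd (measurableSet_singleton 1) using 1
      ext ω
      by_cases h : (X · ω) ∈ E <;> simp [h]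
    simp only [measureReal_def, ProbabilityTheory.cond_apply hEm, ENNReal.toReal_mul, mul_assoc]
    congr 1
    have hiff : ∀ ω, (∀ i : Fin n, X i ω = h i) → ((X · ω) ∈ E ↔ extend h ∈ E) := by
      intro ω hω
      refine iff_of_eq (hE fun i hi => ?_)
      have hin : i < n := lt_of_lt_of_le hi hn
      simp only [extend, dif_pos hin]
      exact hω ⟨i, hin⟩
    by_cases hh : extend h ∈ E
    · have e1 : {ω | (X · ω) ∈ E} ∩ {ω | (∀ i : Fin n, X i ω = h i) ∧ X n ω = 1} =
          {ω | (∀ i : Fin n, X i ω = h i) ∧ X n ω = 1} :=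
        Set.inter_eq_right.2 fun ω hω => (hiff ω hω.1).2 hh
      have e2 : {ω | (X · ω) ∈ E} ∩ {ω | ∀ i : Fin n, X i ω = h i} =
          {ω | ∀ i : Fin n, X i ω = h i} :=
        Set.inter_eq_right.2 fun ω hω => (hiff ω hω).2 hh
      rw [e1, e2]
      exact hX.transition n (hN.trans hn) h
    · have e1 : {ω | (X · ω) ∈ E} ∩ {ω | (∀ i : Fin n, X i ω = h i) ∧ X n ω = 1} = ∅ :=
        Set.eq_empty_of_forall_notMem fun ω hω => hh ((hiff ω hω.2.1).1 hω.1)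
      have e2 : {ω | (X · ω) ∈ E} ∩ {ω | ∀ i : Fin n, X i ω = h i} = ∅ :=
        Set.eq_empty_of_forall_notMem fun ω hω => hh ((hiff ω hω.2).1 hω.1)
      rw [e1, e2]
      simp

end IsStepProcess

/-! ### The walk as an urn and as a process of signs -/

/-- The conditional mean of the next step of the walk when the average is `x`. -/
noncomputable def stepMean (p : ℝ) (k : ℕ) (x : ℝ) : ℝ := 2 * urnFunction p k ((1 + x) / 2) - 1

lemma IsERW.real_transition {p xM : ℝ} {k M : ℕ} (hk : Odd k) (hM : 1 ≤ M) {Ω : Type u}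
    [MeasurableSpace Ω] {μ : Measure Ω} {X : ℕ → Ω → ℝ} (hX : IsERW p k M xM μ X) {n : ℕ}
    (hn : M ≤ n) (h : Fin n → ℝ) :
    μ.real {ω | (∀ i : Fin n, X i ω = h i) ∧ X n ω = 1} =
      μ.real {ω | ∀ i : Fin n, X i ω = h i} * urnFunction p k ((1 + (∑ i, h i) / n) / 2) := by
  by_cases hh : ∀ i, h i = 1 ∨ h i = -1
  · rw [hX.transition n hn h, probUp_eq_urnFunction p hk (hM.trans hn) hh]
  · have e1 : {ω | ∀ i : Fin n, X i ω = h i} = ∅ :=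
      Set.eq_empty_of_forall_notMem fun ω hω => hh fun i => by
        rw [← show X i ω = h i from hω i]; exact hX.step_eq i ω
    have e2 : {ω | (∀ i : Fin n, X i ω = h i) ∧ X n ω = 1} = ∅ :=
      Set.eq_empty_of_forall_notMem fun ω hω => by
        have : ω ∈ {ω | ∀ i : Fin n, X i ω = h i} := hω.1
        rw [e1] at this
        exact this
    rw [e1, e2]
    simp

lemma avg_one_add_div_two (z : ℕ → ℝ) {n : ℕ} (hn : 1 ≤ n) :
    avg (fun i => (1 + z i) / 2) n = (1 + avg z n) / 2 := by
  have : (n : ℝ) ≠ 0 := by positivity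
  simp only [avg]
  rw [← Finset.sum_div, Finset.sum_add_distrib]
  simp only [Finset.sum_const, Finset.card_range, nsmul_eq_mul, mul_one]
  field_simp

lemma IsERW.isHLSUrn {p xM : ℝ} {k M : ℕ} (h0 : 0 ≤ p) (h1 : p ≤ 1) (hk : Odd k) (hM : 1 ≤ M)
    {Ω : Type u} [MeasurableSpace Ω] {μ : Measure Ω} {X : ℕ → Ω → ℝ} (hX : IsERW p k M xM μ X) :
    IsHLSUrn (urnFunction p k) M ((1 + xM) / 2) μ (fun n ω => (1 + X n ω) / 2) where
  urnFunction_mem y hy := urnFunction_mem_Icc h0 h1 k hy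
  measurable n := ((hX.measurable n).const_add 1).div_const 2
  ball_eq n ω := by rcases hX.step_eq n ω with h | h <;> norm_num [h]
  initial := by
    filter_upwards [hX.initial] with ω hω
    rw [avg_one_add_div_two _ hM, hω]
  transition n hn h := by
    have e : ∀ x y : ℝ, (1 + x) / 2 = y ↔ x = 2 * y - 1 := fun x y =>
      ⟨fun h => by linarith, fun h => by linarith⟩
    have hn' : (n : ℝ) ≠ 0 := by have := hM.trans hn; positivity
    have e1 : (1 + (∑ i, (2 * h i - 1)) / (n : ℝ)) / 2 = (∑ i, h i) / n := by
      rw [Finset.sum_sub_distrib, ← Finset.mul_sum]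
      simp only [Finset.sum_const, Finset.card_univ, Fintype.card_fin, nsmul_eq_mul, mul_one]
      field_simp
      ring
    have key := hX.real_transition hk hM hn (fun i => 2 * h i - 1)
    rw [e1] at key
    simp only [e]
    norm_num
    exact key

lemma IsERW.isStepProcess {p xM : ℝ} {k M : ℕ} (h0 : 0 ≤ p) (h1 : p ≤ 1) (hk : Odd k)
    (hM : 1 ≤ M) {Ω : Type u} [MeasurableSpace Ω] {μ : Measure Ω} {X : ℕ → Ω → ℝ}
    (hX : IsERW p k M xM μ X) : IsStepProcess (stepMean p k) M μ X where
  mean_mem x hx := by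
    obtain ⟨ha, hb⟩ := urnFunction_mem_Icc h0 h1 k (y := (1 + x) / 2)
      ⟨by linarith [hx.1], by linarith [hx.2]⟩
    constructor <;> simp only [stepMean] <;> linarith
  measurable := hX.measurable
  step_eq := hX.step_eq
  transition n hn h := by
    rw [hX.real_transition hk hM hn h, stepMean]
    congr 1
    ring

lemma stepMean_one (p x : ℝ) : stepMean p 1 x = (2 * p - 1) * x := by
  have : Finset.Ioc (1 / 2) 1 = {1} := by decide
  rw [stepMean, urnFunction, majorityPoly, this]
  simp
  ring

lemma stepMean_three (p x : ℝ) : stepMean p 3 x = (2 * p - 1) * (3 * x - x ^ 3) / 2 := by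
  have : Finset.Ioc (3 / 2) 3 = {2, 3} := by decide
  rw [stepMean, urnFunction, majorityPoly, this, Finset.sum_insert (by simp),
    Finset.sum_singleton]
  norm_num [Nat.choose]
  ring

/-! ### A deterministic recursion with decreasing steps -/

section Recursion

variable {b : ℝ → ℝ} {x r : ℕ → ℝ} {B : ℝ} {M : ℕ}

/-- A level at which the drift is negative is crossed upwards only finitely often. -/
lemma eventually_le_of_drift_neg (hb : Continuous b) (hx : ∀ n, |x n| ≤ B)
    (hr : Tendsto r atTop (𝓝 0))
    (hrec : ∀ n, M ≤ n → x (n + 1) - r (n + 1) = x n - r n + b (x n) / (n + 1))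
    {c : ℝ} (hc : b c < 0) (hfreq : ∃ᶠ n in atTop, x n - r n < c) :
    ∀ᶠ n in atTop, x n - r n ≤ c := by
  obtain ⟨K, hK⟩ := (isCompact_Icc (a := -B) (b := B)).exists_bound_of_continuousOn hb.continuousOn
  obtain ⟨ρ, hρ, hball⟩ := Metric.eventually_nhds_iff.1 (hb.continuousAt.eventually_lt_const hc)
  have h1 : ∀ᶠ n in atTop, |r n| < ρ / 2 := by
    have := hr.eventually (Metric.ball_mem_nhds 0 (half_pos hρ))
    simpa using this
  have h2 : ∀ᶠ n : ℕ in atTop, K / ((n : ℝ) + 1) < ρ / 2 :=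
    ((tendsto_const_div_atTop_nhds_zero_nat K).comp (tendsto_add_atTop_nat 1)).eventually_lt_const
      (half_pos hρ) |>.mono fun n hn => by simpa using hn
  obtain ⟨n₁, hn₁⟩ := eventually_atTop.1 (h1.and h2)
  obtain ⟨n₀, hn₀, hlt⟩ := frequently_atTop.1 hfreq (max n₁ M)
  refine eventually_atTop.2 ⟨n₀, fun n hn => ?_⟩
  induction n, hn using Nat.le_induction with
  | base => exact hlt.le
  | succ n hn ih =>
    have hnM : M ≤ n := (le_max_right _ _).trans (hn₀.trans hn)
    obtain ⟨ha, hb'⟩ := hn₁ n ((le_max_left _ _).trans (hn₀.trans hn))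
    rw [hrec n hnM]
    have hpos : (0 : ℝ) < n + 1 := by positivity
    obtain ⟨ha1, ha2⟩ := abs_lt.1 ha
    by_cases hnear : c - ρ / 2 < x n - r n
    · have hneg : b (x n) < 0 := by
        apply hball
        rw [Real.dist_eq, abs_lt]
        constructor <;> linarith
      have : b (x n) / (n + 1) < 0 := div_neg_of_neg_of_pos hneg hpos
      linarith
    · have hle : b (x n) ≤ K := (le_abs_self _).trans (hK _ (abs_le.1 (hx n)))
      have : b (x n) / (n + 1) ≤ K / (n + 1) := by gcongr
      linarith

/-- The drift cannot stay negative in the limit, as the step sizes are not summable. -/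
lemma not_drift_neg_of_tendsto (hb : Continuous b) (hr : Tendsto r atTop (𝓝 0))
    (hrec : ∀ n, M ≤ n → x (n + 1) - r (n + 1) = x n - r n + b (x n) / (n + 1))
    {l : ℝ} (hl : Tendsto x atTop (𝓝 l)) : ¬ b l < 0 := by
  intro hneg
  obtain ⟨n₁, hn₁⟩ := eventually_atTop.1 (((hb.tendsto l).comp hl).eventually_lt_const
    (show b l < b l / 2 by linarith))
  set w : ℕ → ℝ := fun n => x n - r n + -(b l / 2) * ∑ i ∈ Finset.range n, (1 / ((i : ℝ) + 1))
    with hw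
  have hwtop : Tendsto w atTop atTop :=
    (hl.sub hr).add_atTop
      (Real.tendsto_sum_range_one_div_nat_succ_atTop.const_mul_atTop (by linarith))
  have hanti : ∀ n, max n₁ M ≤ n → w n ≤ w (max n₁ M) := by
    intro n hn
    induction n, hn using Nat.le_induction with
    | base => exact le_rfl
    | succ n hn ih =>
      refine le_trans ?_ ih
      simp only [hw]
      rw [Finset.sum_range_succ, hrec n ((le_max_right _ _).trans hn)]
      have h := hn₁ n ((le_max_left _ _).trans hn)
      simp only [Function.comp] at h
      have : b (x n) / (n + 1) ≤ b l / 2 / (n + 1) := by gcongr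
      have e : b l / 2 / ((n : ℝ) + 1) = b l / 2 * (1 / (n + 1)) := by ring
      rw [e] at this
      linarith
  obtain ⟨n, hn, hgt⟩ := ((eventually_ge_atTop (max n₁ M)).and
    (hwtop.eventually_gt_atTop (w (max n₁ M)))).exists
  exact absurd (hanti n hn) (not_le.2 hgt)

/-- A bounded sequence that follows the drift `b` with step sizes `1 / (n + 1)`, up to an error
that tends to zero, converges to a zero of `b`. -/
lemma exists_tendsto_zero_of_drift (hb : Continuous b) (hd : Dense {c | b c ≠ 0})
    (hx : ∀ n, |x n| ≤ B) (hr : Tendsto r atTop (𝓝 0))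
    (hrec : ∀ n, M ≤ n → x (n + 1) - r (n + 1) = x n - r n + b (x n) / (n + 1)) :
    ∃ l, Tendsto x atTop (𝓝 l) ∧ b l = 0 := by
  have hb' : Continuous fun y => -b (-y) := (hb.comp continuous_neg).neg
  have hr' : Tendsto (fun n => -r n) atTop (𝓝 0) := by simpa using hr.neg
  have hx' : ∀ n, |-x n| ≤ B := fun n => by rw [abs_neg]; exact hx n
  have hrec' : ∀ n, M ≤ n →
      -x (n + 1) - -r (n + 1) = -x n - -r n + -b (- -x n) / (n + 1) := by
    intro n hn
    have := hrec n hn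
    rw [neg_neg, neg_div]
    linarith
  have hbdd : ∀ᶠ n in atTop, |x n - r n| ≤ B + 1 := by
    have := hr.eventually (Metric.ball_mem_nhds 0 one_pos)
    filter_upwards [this] with n hn
    have hn' : |r n| < 1 := by simpa using hn
    exact (abs_sub _ _).trans (add_le_add (hx n) hn'.le)
  obtain ⟨l, hl⟩ : ∃ l, Tendsto (fun n => x n - r n) atTop (𝓝 l) := by
    refine tendsto_of_no_upcrossings hd ?_
      ⟨B + 1, eventually_map.2 (hbdd.mono fun n hn => (abs_le.1 hn).2)⟩
      ⟨-(B + 1), eventually_map.2 (hbdd.mono fun n hn => (abs_le.1 hn).1)⟩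
    rintro a ha c - hac ⟨h1, h2⟩
    rcases lt_or_gt_of_ne ha with hneg | hpos
    · have := eventually_le_of_drift_neg hb hx hr hrec hneg h1
      obtain ⟨n, hn1, hn2⟩ := (h2.and_eventually this).exists
      linarith
    · have h3 : ∃ᶠ n in atTop, -x n - -r n < -a :=
        h2.mono fun n hn => by linarith
      have := eventually_le_of_drift_neg hb' hx' hr' hrec' (c := -a) (by simpa using hpos) h3
      obtain ⟨n, hn1, hn2⟩ := (h1.and_eventually this).exists
      linarith
  have hxl : Tendsto x atTop (𝓝 l) := by simpa using hl.add hr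
  refine ⟨l, hxl, ?_⟩
  rcases lt_trichotomy (b l) 0 with h | h | h
  · exact absurd h (not_drift_neg_of_tendsto hb hr hrec hxl)
  · exact h
  · refine absurd ?_ (not_drift_neg_of_tendsto hb' hr' hrec' hxl.neg)
    simpa using h

end Recursion

/-! ### Almost sure convergence to a zero of the drift -/

/-- The noise accumulated between the times `M` and `n`. -/
noncomputable def noise (g : ℝ → ℝ) (M n : ℕ) (z : ℕ → ℝ) : ℝ :=
  ∑ j ∈ Finset.Ico M n, (z j - g (avg z j)) / (j + 1)

lemma dependsOn_noise (g : ℝ → ℝ) (M n : ℕ) : DependsOn (noise g M n) (Set.Iio n) := by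
  intro x y hxy
  refine Finset.sum_congr rfl fun j hj => ?_
  have hjn := (Finset.mem_Ico.1 hj).2
  rw [hxy j hjn, show avg x j = avg y j from dependsOn_avg hjn.le hxy]

lemma noise_succ (g : ℝ → ℝ) {M n : ℕ} (h : M ≤ n) (z : ℕ → ℝ) :
    noise g M (n + 1) z = noise g M n z + (z n - g (avg z n)) / (n + 1) :=
  Finset.sum_Ico_succ_top h _

lemma noise_of_le (g : ℝ → ℝ) {M n : ℕ} (h : n ≤ M) (z : ℕ → ℝ) : noise g M n z = 0 := by
  simp [noise, Finset.Ico_eq_empty_of_le h]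

namespace IsStepProcess

variable {g : ℝ → ℝ} {M : ℕ} {Ω : Type u} [MeasurableSpace Ω] {μ : Measure Ω} {X : ℕ → Ω → ℝ}

lemma martingale_noise [IsProbabilityMeasure μ] (hX : IsStepProcess g M μ X) :
    Martingale (fun n ω => noise g M n (X · ω)) hX.history μ := by
  classical
  refine martingale_of_setIntegral_eq_succ
    (fun n => (hX.measurable_history_apply (dependsOn_noise g M n)).stronglyMeasurable)
    (fun n => hX.integrable_apply (dependsOn_noise g M n)) fun n s hs => ?_
  rcases le_or_gt M n with hn | hn
  swap
  · simp only [noise_of_le g hn, noise_of_le g hn.le]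
  have hms : MeasurableSet s := hX.history.le n _ hs
  obtain ⟨S, -, rfl⟩ := hs
  set F : (ℕ → ℝ) → ℝ := fun z => (if (fun i : Fin n => z i) ∈ S then 1 else 0) / (n + 1) with hFdef
  have hF : DependsOn F (Set.Iio n) := by
    intro x y hxy
    have : (fun i : Fin n => x i) = fun i : Fin n => y i := funext fun i => hxy i i.2
    simp only [hFdef, this]
  have h0 : ∫ ω in (fun ω (i : Fin n) => X i ω) ⁻¹' S,
      (X n ω - g (avg (X · ω) n)) / (n + 1) ∂μ = 0 := by
    rw [← hX.integral_mul_sub_mean hn hF, ← integral_indicator hms]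
    congr 1
    ext ω
    by_cases hω : (fun i : Fin n => X i ω) ∈ S
    · rw [Set.indicator_of_mem (by exact hω)]
      simp only [hFdef, if_pos hω]
      ring
    · rw [Set.indicator_of_notMem (by exact hω)]
      simp only [hFdef, if_neg hω]
      ring
  have hint := (hX.integrable_apply (dependsOn_noise g M n)).restrict
    (s := (fun ω (i : Fin n) => X i ω) ⁻¹' S)
  have hint' := (hX.integrable_apply (dependsOn_noise g M (n + 1))).restrict
    (s := (fun ω (i : Fin n) => X i ω) ⁻¹' S)
  rw [eq_comm, ← sub_eq_zero, ← integral_sub hint' hint, ← h0]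
  simp only [noise_succ g hn, add_sub_cancel_left]

lemma integral_noise_sq_succ_le [IsProbabilityMeasure μ] (hX : IsStepProcess g M μ X) {n : ℕ}
    (hn : M ≤ n) : ∫ ω, noise g M (n + 1) (X · ω) ^ 2 ∂μ ≤
      ∫ ω, noise g M n (X · ω) ^ 2 ∂μ + 4 * (1 / ((n : ℝ) + 1) ^ 2) := by
  have hpos : (0 : ℝ) < (n : ℝ) + 1 := by positivity
  set F : (ℕ → ℝ) → ℝ := fun z => 2 * noise g M n z / (n + 1) with hFdef
  have hF : DependsOn F (Set.Iio n) := by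
    intro x y hxy
    simp only [hFdef, show noise g M n x = noise g M n y from dependsOn_noise g M n hxy]
  have hmono : Monotone (Set.Iio : ℕ → Set ℕ) := fun _ _ h => Set.Iio_subset_Iio h
  have hint1 : Integrable (fun ω => noise g M n (X · ω) ^ 2) μ :=
    hX.integrable_apply (n := n) (F := fun z => noise g M n z ^ 2) fun x y hxy => by
      simp only [show noise g M n x = noise g M n y from dependsOn_noise g M n hxy]
  have hint2 : Integrable (fun ω => F (X · ω) * (X n ω - g (avg (X · ω) n))) μ :=
    hX.integrable_apply (n := n + 1) (F := fun z => F z * (z n - g (avg z n))) fun x y hxy => by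
      simp only [show avg x n = avg y n from dependsOn_avg (Nat.le_succ n) hxy,
        hF fun i hi => hxy i (hmono (Nat.le_succ n) hi), hxy n (Nat.lt_succ_self n)]
  calc ∫ ω, noise g M (n + 1) (X · ω) ^ 2 ∂μ
      ≤ ∫ ω, (noise g M n (X · ω) ^ 2 + F (X · ω) * (X n ω - g (avg (X · ω) n)) +
          4 * (1 / ((n : ℝ) + 1) ^ 2)) ∂μ := by
        refine integral_mono (hX.integrable_apply (n := n + 1)
          (F := fun z => noise g M (n + 1) z ^ 2) fun x y hxy => ?_)
          ((hint1.add hint2).add (integrable_const _)) fun ω => ?_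
        · simp only [show noise g M (n + 1) x = noise g M (n + 1) y from
            dependsOn_noise g M (n + 1) hxy]
        · simp only [noise_succ g hn, hFdef]
          obtain ⟨h1, h2⟩ := hX.mean_avg_mem n ω
          have h3 : (X n ω - g (avg (X · ω) n)) ^ 2 ≤ 4 := by
            rcases hX.step_eq n ω with h | h <;> rw [h] <;> nlinarith
          have h4 : (X n ω - g (avg (X · ω) n)) ^ 2 / ((n : ℝ) + 1) ^ 2 ≤ 4 / ((n : ℝ) + 1) ^ 2 := by
            gcongr
          have h5 : (noise g M n (X · ω) + (X n ω - g (avg (X · ω) n)) / ((n : ℝ) + 1)) ^ 2 =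
              noise g M n (X · ω) ^ 2 +
                2 * noise g M n (X · ω) / (n + 1) * (X n ω - g (avg (X · ω) n)) +
                (X n ω - g (avg (X · ω) n)) ^ 2 / ((n : ℝ) + 1) ^ 2 := by
            rw [← div_pow]
            ring
          rw [h5, mul_one_div]
          linarith
    _ = _ := by
        have hint3 : Integrable (fun ω => noise g M n (X · ω) ^ 2 +
          F (X · ω) * (X n ω - g (avg (X · ω) n))) μ := hint1.add hint2
        rw [integral_add hint3 (integrable_const _), integral_add hint1 hint2, hX.integral_mul_sub_mean hn hF]
        simp

lemma exists_integral_noise_sq_le [IsProbabilityMeasure μ] (hX : IsStepProcess g M μ X) :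
    ∃ C, ∀ n, ∫ ω, noise g M n (X · ω) ^ 2 ∂μ ≤ C := by
  have hs : Summable fun n : ℕ => 4 * (1 / ((n : ℝ) + 1) ^ 2) := by
    have h := (summable_nat_add_iff 1).2 (Real.summable_one_div_nat_pow.2 one_lt_two)
    simpa using h.mul_left 4
  have hnn : ∀ n : ℕ, 0 ≤ 4 * (1 / ((n : ℝ) + 1) ^ 2) := fun n => by positivity
  have h : ∀ n, ∫ ω, noise g M n (X · ω) ^ 2 ∂μ ≤
      ∑ j ∈ Finset.range n, 4 * (1 / ((j : ℝ) + 1) ^ 2) := by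
    intro n
    induction n with
    | zero => simp [noise_of_le g (Nat.zero_le M)]
    | succ n ih =>
      rcases le_or_gt M n with hn | hn
      · rw [Finset.sum_range_succ]
        linarith [hX.integral_noise_sq_succ_le hn]
      · simp only [noise_of_le g (Nat.succ_le_of_lt hn)]
        simpa using Finset.sum_nonneg fun j _ => hnn j
  exact ⟨_, fun n => (h n).trans (hs.sum_le_tsum _ fun j _ => hnn j)⟩

lemma ae_exists_tendsto_noise [IsProbabilityMeasure μ] (hX : IsStepProcess g M μ X) :
    ∀ᵐ ω ∂μ, ∃ T, Tendsto (fun n => noise g M n (X · ω)) atTop (𝓝 T) := by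
  obtain ⟨C, hC⟩ := hX.exists_integral_noise_sq_le
  refine hX.martingale_noise.submartingale.exists_ae_tendsto_of_bdd (R := (C + 1).toNNReal)
    fun n => ?_
  have hint := hX.integrable_apply (dependsOn_noise g M n)
  have hint2 : Integrable (fun ω => noise g M n (X · ω) ^ 2) μ :=
    hX.integrable_apply (n := n) (F := fun z => noise g M n z ^ 2) fun x y hxy => by
      simp only [show noise g M n x = noise g M n y from dependsOn_noise g M n hxy]
  rw [eLpNorm_one_eq_lintegral_enorm, ← ofReal_integral_norm_eq_lintegral_enorm hint]
  refine ENNReal.ofReal_le_ofReal ?_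
  calc ∫ ω, ‖noise g M n (X · ω)‖ ∂μ ≤ ∫ ω, (noise g M n (X · ω) ^ 2 + 1) ∂μ := by
        refine integral_mono hint.norm (hint2.add (integrable_const 1)) fun ω => ?_
        simp only [Real.norm_eq_abs]
        rw [← sq_abs]
        nlinarith [sq_nonneg (|noise g M n (X · ω)| - 1)]
    _ ≤ C + 1 := by
        rw [integral_add hint2 (integrable_const 1)]
        simpa using hC n

/-- The averages converge almost surely to a zero of the drift. -/
lemma ae_exists_tendsto_avg [IsProbabilityMeasure μ] (hX : IsStepProcess g M μ X)
    (hg : Continuous g) (hd : Dense {c | g c ≠ c}) :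
    ∀ᵐ ω ∂μ, ∃ l ∈ Set.Icc (-1 : ℝ) 1, Tendsto (avg (X · ω)) atTop (𝓝 l) ∧ g l = l := by
  filter_upwards [hX.ae_exists_tendsto_noise] with ω ⟨T, hT⟩
  obtain ⟨l, hl, hl0⟩ := exists_tendsto_zero_of_drift (b := fun y => g y - y)
    (x := avg (X · ω)) (r := fun n => noise g M n (X · ω) - T) (B := 1) (M := M)
    (hg.sub continuous_id) (by simpa [sub_eq_zero] using hd)
    (fun n => abs_le.2 (hX.avg_mem n ω)) (by simpa using hT.sub_const T)
    (fun n hn => by rw [noise_succ g hn, avg_succ]; ring)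
  exact ⟨l, isClosed_Icc.mem_of_tendsto hl (Eventually.of_forall fun n => hX.avg_mem n ω), hl,
    sub_eq_zero.1 hl0⟩

end IsStepProcess

/-! ### Exponential barriers -/

/-- If the next sign has mean at least `m > a`, then `exp (-r * (sign - a))` has mean at most `1`
for a suitable rate `r > 0`: at `r = 0` that mean is `1`, with derivative `a - m < 0`. -/
lemma exists_rate {a m : ℝ} (h : a < m) : ∃ r : ℝ, 0 < r ∧ ∀ m', m ≤ m' →
    (1 + m') / 2 * Real.exp (-r * (1 - a)) + (1 - m') / 2 * Real.exp (-r * (-1 - a)) ≤ 1 := by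
  set f : ℝ → ℝ := fun r =>
    (1 + m) / 2 * Real.exp (-r * (1 - a)) + (1 - m) / 2 * Real.exp (-r * (-1 - a)) with hf
  have hd : HasDerivAt f (a - m) 0 := by
    have h1 := (((hasDerivAt_id (0 : ℝ)).neg.mul_const (1 - a)).exp).const_mul ((1 + m) / 2)
    have h2 := (((hasDerivAt_id (0 : ℝ)).neg.mul_const (-1 - a)).exp).const_mul ((1 - m) / 2)
    exact (h1.add h2).congr_deriv (by simp; ring)
  have hslope := (hasDerivAt_iff_tendsto_slope.1 hd).mono_left
    (nhdsWithin_mono (0 : ℝ) (fun y (hy : y ∈ Set.Ioi (0 : ℝ)) => ne_of_gt hy))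
  obtain ⟨r, hr, hr0⟩ := ((hslope.eventually_lt_const (sub_neg.2 h)).and
    self_mem_nhdsWithin).exists
  have hr0' : 0 < r := hr0
  refine ⟨r, hr0', fun m' hm' => ?_⟩
  have hf0 : f 0 = 1 := by simp [hf]; ring
  rw [slope_def_field, hf0, sub_zero, div_neg_iff] at hr
  have hfr : f r < 1 := by
    rcases hr with ⟨-, h⟩ | ⟨h, -⟩ <;> linarith
  have hexp : Real.exp (-r * (1 - a)) ≤ Real.exp (-r * (-1 - a)) :=
    Real.exp_le_exp.2 (by nlinarith)
  simp only [hf] at hfr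
  nlinarith

/-- The truncated exponential of the excess of the partial sum over the line of slope `a`. -/
noncomputable def barrier (r a : ℝ) (n : ℕ) (z : ℕ → ℝ) : ℝ :=
  min 1 (Real.exp (-r * ∑ i ∈ Finset.range n, (z i - a)))

lemma dependsOn_barrier (r a : ℝ) (n : ℕ) : DependsOn (barrier r a n) (Set.Iio n) := by
  intro x y hxy
  simp only [barrier]
  rw [Finset.sum_congr rfl fun i hi => by rw [hxy i (Finset.mem_range.1 hi)]]

lemma sum_sub_eq (z : ℕ → ℝ) (a : ℝ) {n : ℕ} (hn : 1 ≤ n) :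
    ∑ i ∈ Finset.range n, (z i - a) = n * (avg z n - a) := by
  have : (n : ℝ) ≠ 0 := by positivity
  rw [avg, Finset.sum_sub_distrib]
  simp only [Finset.sum_const, Finset.card_range, nsmul_eq_mul]
  field_simp

namespace IsStepProcess

variable {g : ℝ → ℝ} {M : ℕ} {Ω : Type u} [MeasurableSpace Ω] {μ : Measure Ω} {X : ℕ → Ω → ℝ}

/-- The barrier is a supermartingale: above the line the exponential is one, and below the line
the barrier has its maximal value. -/
lemma integral_barrier_succ_le [IsProbabilityMeasure μ] (hX : IsStepProcess g M μ X) {r a m : ℝ}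
    (hr : 0 < r) (hrate : ∀ m', m ≤ m' →
      (1 + m') / 2 * Real.exp (-r * (1 - a)) + (1 - m') / 2 * Real.exp (-r * (-1 - a)) ≤ 1)
    (hg : ∀ x ∈ Set.Icc a 1, m ≤ g x) {n : ℕ} (hn : M ≤ n) (hn1 : 1 ≤ n) :
    ∫ ω, barrier r a (n + 1) (X · ω) ∂μ ≤ ∫ ω, barrier r a n (X · ω) ∂μ := by
  set F : (ℕ → ℝ) → ℝ → ℝ := fun z t =>
    min 1 (Real.exp (-r * (∑ i ∈ Finset.range n, (z i - a) + (t - a)))) with hF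
  have hdep : ∀ t, DependsOn (fun z => F z t) (Set.Iio n) := by
    intro t x y hxy
    simp only [hF]
    rw [Finset.sum_congr rfl fun i hi => by rw [hxy i (Finset.mem_range.1 hi)]]
  have e : ∀ z : ℕ → ℝ, barrier r a (n + 1) z = F z (z n) := fun z => by
    simp only [barrier, hF, Finset.sum_range_succ]
  simp only [e]
  rw [hX.integral_step hn hdep]
  refine integral_mono (hX.integrable_apply (dependsOn_mean g hdep))
    (hX.integrable_apply (dependsOn_barrier r a n)) fun ω => ?_
  obtain ⟨hg1, hg2⟩ := hX.mean_avg_mem n ω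
  simp only
  set m' := g (avg (X · ω) n) with hm'
  have hsplit : ∀ t, F (X · ω) t ≤
      Real.exp (-r * ∑ i ∈ Finset.range n, (X i ω - a)) * Real.exp (-r * (t - a)) := fun t => by
    rw [← Real.exp_add, ← mul_add]
    exact min_le_right _ _
  by_cases hpos : 0 ≤ ∑ i ∈ Finset.range n, (X i ω - a)
  · have hle : Real.exp (-r * ∑ i ∈ Finset.range n, (X i ω - a)) ≤ 1 :=
      Real.exp_le_one_iff.2 (by nlinarith)
    have hav : a ≤ avg (X · ω) n := by
      rw [sum_sub_eq _ _ hn1] at hpos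
      exact sub_nonneg.1 (nonneg_of_mul_nonneg_right hpos (by positivity))
    have hmm := hrate m' (hg _ ⟨hav, (hX.avg_mem n ω).2⟩)
    rw [barrier, min_eq_right hle]
    have h1 := hsplit 1
    have h2 := hsplit (-1)
    have hE := Real.exp_pos (-r * ∑ i ∈ Finset.range n, (X i ω - a))
    nlinarith
  · have hge : 1 ≤ Real.exp (-r * ∑ i ∈ Finset.range n, (X i ω - a)) :=
      Real.one_le_exp (by nlinarith)
    rw [barrier, min_eq_left hge]
    have h1 : F (X · ω) 1 ≤ 1 := min_le_left _ _
    have h2 : F (X · ω) (-1) ≤ 1 := min_le_left _ _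
    nlinarith

/-- A limit below `a` is exponentially unlikely when the walk is above `δ > a` at time `M` and the
drift at the levels above `a` points upwards relative to `a`. -/
lemma real_limitEvent_le [IsProbabilityMeasure μ] (hX : IsStepProcess g M μ X) {r a m δ l : ℝ}
    (hr : 0 < r) (hrate : ∀ m', m ≤ m' →
      (1 + m') / 2 * Real.exp (-r * (1 - a)) + (1 - m') / 2 * Real.exp (-r * (-1 - a)) ≤ 1)
    (hg : ∀ x ∈ Set.Icc a 1, m ≤ g x) (hM : 1 ≤ M) (hδ : ∀ᵐ ω ∂μ, δ ≤ avg (X · ω) M)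
    (hl : l < a) : μ.real (limitEvent X l) ≤ Real.exp (-(r * (δ - a)) * M) := by
  have hint := fun n => hX.integrable_apply (dependsOn_barrier r a n)
  have hinit : ∫ ω, barrier r a M (X · ω) ∂μ ≤ Real.exp (-(r * (δ - a)) * M) := by
    refine (integral_mono_ae (hint M)
      (integrable_const (Real.exp (-(r * (δ - a)) * M))) ?_).trans_eq (by simp)
    filter_upwards [hδ] with ω hω
    refine (min_le_right _ _).trans (Real.exp_le_exp.2 ?_)
    rw [sum_sub_eq _ _ hM]
    have : (M : ℝ) * (δ - a) ≤ M * (avg (X · ω) M - a) := by gcongr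
    nlinarith
  have hle : ∀ n, M ≤ n → ∫ ω, barrier r a n (X · ω) ∂μ ≤ Real.exp (-(r * (δ - a)) * M) := by
    intro n hn
    induction n, hn using Nat.le_induction with
    | base => exact hinit
    | succ n hn ih =>
      exact (hX.integral_barrier_succ_le hr hrate hg hn (hM.trans hn)).trans ih
  have hB : ∀ n, MeasurableSet {ω | avg (X · ω) n < a} := fun n =>
    measurableSet_lt (hX.measurable_avg n) measurable_const
  have hBle : ∀ n, M ≤ n → μ {ω | avg (X · ω) n < a} ≤
      ENNReal.ofReal (Real.exp (-(r * (δ - a)) * M)) := by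
    intro n hn
    rw [← ofReal_measureReal]
    refine ENNReal.ofReal_le_ofReal (le_trans ?_ (hle n hn))
    rw [← integral_indicator_one (hB n)]
    refine integral_mono ((integrable_const 1).indicator (hB n)) (hint n) fun ω => ?_
    by_cases hω : ω ∈ {ω | avg (X · ω) n < a}
    · rw [Set.indicator_of_mem hω]
      refine le_min le_rfl (Real.one_le_exp ?_)
      have h0 : avg (X · ω) n < a := hω
      rw [sum_sub_eq _ _ (hM.trans hn)]
      have : (0 : ℝ) ≤ n := Nat.cast_nonneg n
      have := mul_nonneg (mul_nonneg hr.le this) (sub_nonneg.2 h0.le)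
      linarith
    · rw [Set.indicator_of_notMem hω]
      exact le_min zero_le_one (Real.exp_pos _).le
  have hsub : limitEvent X l ⊆ ⋃ k, ⋂ n, ⋂ (_ : k ≤ n), {ω | avg (X · ω) n < a} := by
    intro ω hω
    obtain ⟨k, hk⟩ := eventually_atTop.1 (Tendsto.eventually_lt_const hl hω)
    exact Set.mem_iUnion.2 ⟨k, Set.mem_iInter₂.2 hk⟩
  have hmono : Monotone fun k => ⋂ n, ⋂ (_ : k ≤ n), {ω | avg (X · ω) n < a} :=
    fun k k' hk => Set.biInter_subset_biInter_left fun n hn => le_trans hk hn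
  refine ENNReal.toReal_le_of_le_ofReal (Real.exp_pos _).le ((measure_mono hsub).trans ?_)
  rw [hmono.measure_iUnion]
  exact iSup_le fun k => (measure_mono (Set.biInter_subset_of_mem
    (show k ≤ max k M from le_max_left _ _))).trans (hBle _ (le_max_right _ _))

end IsStepProcess

/-! ### A potential at the unstable equilibrium -/

lemma neg_log_one_add_le {q : ℝ} (hq : |q| ≤ 1 / 2) :
    -Real.log (1 + q) ≤ -q + q ^ 2 / 2 + 2 * |q| ^ 3 := by
  have h := Real.abs_log_sub_add_sum_range_le (x := -q) (by rw [abs_neg]; linarith) 2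
  rw [abs_neg] at h
  simp only [Finset.sum_range_succ, Finset.sum_range_zero] at h
  norm_num at h
  have h3 : |q| ^ 3 / (1 - |q|) ≤ 2 * |q| ^ 3 := by
    rw [div_le_iff₀ (by linarith)]
    nlinarith [pow_nonneg (abs_nonneg q) 3]
  have h4 := (abs_le.1 h).1
  linarith

lemma inv_one_add_le {q : ℝ} (hq : |q| ≤ 1 / 2) :
    1 / (1 + q) ≤ 1 - q + q ^ 2 + 2 * |q| ^ 3 := by
  obtain ⟨h1, h2⟩ := abs_le.1 hq
  have hpos : 0 < 1 + q := by linarith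
  have e : 1 / (1 + q) = 1 - q + q ^ 2 + -q ^ 3 / (1 + q) := by field_simp; ring
  rw [e]
  have : -q ^ 3 / (1 + q) ≤ 2 * |q| ^ 3 := by
    rw [div_le_iff₀ hpos]
    have h3 : -q ^ 3 ≤ |q| ^ 3 := by rw [← abs_pow]; exact neg_le_abs _
    nlinarith [pow_nonneg (abs_nonneg q) 3]
  linarith

/-- The effect on `-log (u / 9) + 24 * (k / u)` of replacing `u` by `u * (1 + q)` and `k` by
`k * (1 - s)`, to second order in `q`. -/
lemma potential_perturb {u k s q : ℝ} (hk : 0 < k) (hku : k ≤ u) (hs0 : 0 ≤ s)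
    (hs1 : s ≤ 1) (hq : |q| ≤ 1 / 2) :
    -Real.log (u * (1 + q) / 9) + 24 * (k * (1 - s) / (u * (1 + q))) ≤
      -Real.log (u / 9) + 24 * (k / u) + (-(1 + 24 * (k / u)) * q + (1 / 2 + 24 * (k / u)) * q ^ 2
        - 24 * (k / u) * s + 50 * |q| ^ 3 + 24 * (s * |q|)) := by
  have hu : 0 < u := hk.trans_le hku
  obtain ⟨h1, h2⟩ := abs_le.1 hq
  have hpos : 0 < 1 + q := by linarith
  have elog : Real.log (u * (1 + q) / 9) = Real.log (u / 9) + Real.log (1 + q) := by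
    rw [← Real.log_mul (by positivity) hpos.ne']
    congr 1
    ring
  have efrac : k * (1 - s) / (u * (1 + q)) = k / u * ((1 - s) * (1 / (1 + q))) := by
    field_simp
  have hρ0 : 0 ≤ k / u := by positivity
  have hρ1 : k / u ≤ 1 := (div_le_one hu).2 hku
  set ρ := k / u
  have hq3 : 0 ≤ |q| ^ 3 := by positivity
  have hinv : (1 - s) * (1 / (1 + q)) ≤ (1 - q + q ^ 2 - s) + (s * |q| + 2 * |q| ^ 3) := by
    refine (mul_le_mul_of_nonneg_left (inv_one_add_le hq) (sub_nonneg.2 hs1)).trans ?_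
    have ha : s * q ≤ s * |q| := mul_le_mul_of_nonneg_left (le_abs_self q) hs0
    have hb : 0 ≤ s * q ^ 2 := by positivity
    have hc : 0 ≤ s * |q| ^ 3 := by positivity
    nlinarith
  have herr : 0 ≤ s * |q| + 2 * |q| ^ 3 := by positivity
  have hmul := mul_le_mul_of_nonneg_left hinv hρ0
  have hmul2 : ρ * (s * |q| + 2 * |q| ^ 3) ≤ 1 * (s * |q| + 2 * |q| ^ 3) :=
    mul_le_mul_of_nonneg_right hρ1 herr
  have hlog := neg_log_one_add_le hq
  rw [elog, efrac]
  nlinarith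

/-- The relative increment of `x ^ 2 + k` when `x` makes a step of size `s` towards `t` and `k`
decreases to `k * (1 - s)`. -/
noncomputable def relIncr (x k s t : ℝ) : ℝ :=
  (2 * x * (t - x) * s + (t - x) ^ 2 * s ^ 2 - k * s) / (x ^ 2 + k)

/-- The relative increment has the order of `θ = √s`, and its square is to leading order that of the
term linear in `t - x`. -/
lemma relIncr_bounds {x k s θ t : ℝ} (hθ : 0 < θ) (hθ1 : θ ≤ 1) (hs : s = θ ^ 2) (hk : 0 < k)
    (hks : k * (1 - s) = 8 * s) (ht : |t - x| ≤ 2) :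
    |relIncr x k s t| ≤ 2 * θ ∧
      relIncr x k s t ^ 2 ≤ (2 * x * s / (x ^ 2 + k)) ^ 2 * (t - x) ^ 2 + 3 * θ ^ 3 := by
  have hs0 : 0 < s := by rw [hs]; positivity
  have hk8 : 8 * s ≤ k := by nlinarith
  have hu : 0 < x ^ 2 + k := by positivity
  set u := x ^ 2 + k with hudef
  -- by the arithmetic-geometric mean inequality, as `u ≥ x ^ 2 + 4 * θ ^ 2`
  have hα : |2 * x * s / u| ≤ θ / 2 := by
    rw [abs_div, abs_of_pos hu, div_le_iff₀ hu, abs_mul, abs_mul, abs_of_pos hs0, abs_two, hs]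
    have : 4 * |x| * θ ≤ u := by
      rw [hudef, ← sq_abs]
      nlinarith [sq_nonneg (|x| - 2 * θ)]
    nlinarith
  have hA : |2 * x * s / u * (t - x)| ≤ θ := by
    rw [abs_mul]
    calc _ ≤ θ / 2 * 2 := mul_le_mul hα ht (abs_nonneg _) (by positivity)
      _ = θ := by ring
  have ht2 : (t - x) ^ 2 ≤ 4 := by
    rw [← sq_abs]; nlinarith [abs_nonneg (t - x)]
  have hβ0 : 0 ≤ (t - x) ^ 2 * s ^ 2 / u := by positivity
  have hβ : (t - x) ^ 2 * s ^ 2 / u ≤ s := by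
    rw [div_le_iff₀ hu]
    have : (t - x) ^ 2 * s ^ 2 ≤ 4 * s ^ 2 := by gcongr
    nlinarith [sq_nonneg x]
  have hρ0 : 0 ≤ k * s / u := by positivity
  have hρ : k * s / u ≤ s := by
    rw [div_le_iff₀ hu]
    nlinarith [sq_nonneg x]
  have e : relIncr x k s t =
      2 * x * s / u * (t - x) + ((t - x) ^ 2 * s ^ 2 / u - k * s / u) := by
    rw [relIncr, ← hudef]
    ring
  set A := 2 * x * s / u * (t - x) with hAdef
  set e' := (t - x) ^ 2 * s ^ 2 / u - k * s / u
  have he : |e'| ≤ s := abs_le.2 ⟨by linarith, by linarith⟩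
  have hsθ : s ≤ θ := by rw [hs]; nlinarith
  rw [e]
  constructor
  · exact (abs_add_le _ _).trans (by linarith)
  · have h1 : A * e' ≤ θ * s := (le_abs_self _).trans (by
      rw [abs_mul]; exact mul_le_mul hA he (abs_nonneg _) hθ.le)
    have h2 : e' ^ 2 ≤ s ^ 2 := by rw [← sq_abs]; gcongr
    have h3 : (A + e') ^ 2 = (2 * x * s / u) ^ 2 * (t - x) ^ 2 + 2 * (A * e') + e' ^ 2 := by
      rw [hAdef]; ring
    have h4 : θ * s = θ ^ 3 := by rw [hs]; ring
    have h5 : s ^ 2 ≤ θ ^ 3 := by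
      rw [hs, ← pow_mul]; exact pow_le_pow_of_le_one hθ.le hθ1 (by norm_num)
    rw [h3]
    linarith

/-- The main term of the mean increment of the potential, in units of `s`. Here `ρ = k / u` is the
share of `k` in `u = x ^ 2 + k`. Near `ρ = 0` the repulsion `2 * κ * (1 - ρ)` dominates, elsewhere
the bounded part of the potential does. -/
lemma main_term_le {κ ρ : ℝ} (hκ : 0 < κ) (hκ1 : κ ≤ 1 / 2) (h0 : 0 ≤ ρ) (h1 : ρ ≤ 1) :
    -(1 + 24 * ρ) * (2 * κ * (1 - ρ) + ρ * (7 / 128) - ρ) +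
      (1 / 2 + 24 * ρ) * ((1 - ρ) * ρ / 2) - 24 * ρ ≤ -κ / 2 := by
  have h2 : 0 ≤ ρ * (1 - ρ) := mul_nonneg h0 (sub_nonneg.2 h1)
  have h3 : 0 ≤ κ * (ρ * (1 - ρ)) := mul_nonneg hκ.le h2
  have h4 : 0 ≤ ρ * (1 - ρ) ^ 2 := by positivity
  have h5 : 0 ≤ κ * (1 - ρ) := mul_nonneg hκ.le (sub_nonneg.2 h1)
  nlinarith

/-- The mean increment of the potential is nonpositive: the main term is at most `-κ / 2 * s`, and the
terms of third order in `θ = √s` sum up to at most `522 * θ ^ 3`, which is not larger as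
`θ ≤ κ / 1044`. -/
lemma mean_potential_perturb_nonpos {x g k s θ κ : ℝ} (hκ : 0 < κ) (hκ1 : κ ≤ 1 / 2) (hθ : 0 < θ)
    (hθκ : θ ≤ κ / 1044) (hs : s = θ ^ 2) (hk : 0 < k) (hks : k * (1 - s) = 8 * s)
    (hx : |x| ≤ 1 / 3) (hg : |g| ≤ 1) (hg1 : κ * x ^ 2 ≤ x * (g - x)) (hg2 : x * g ≤ 2 * x ^ 2)
    {ψ : ℝ → ℝ} (hψ : ψ = fun q => -(1 + 24 * (k / (x ^ 2 + k))) * q +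
      (1 / 2 + 24 * (k / (x ^ 2 + k))) * q ^ 2 - 24 * (k / (x ^ 2 + k)) * s + 50 * |q| ^ 3 +
      24 * (s * |q|)) :
    (1 + g) / 2 * ψ (relIncr x k s 1) + (1 - g) / 2 * ψ (relIncr x k s (-1)) ≤ 0 := by
  obtain ⟨hx1, hx2⟩ := abs_le.1 hx
  obtain ⟨hga, hgb⟩ := abs_le.1 hg
  have hθ1 : θ ≤ 1 := by linarith
  have hs0 : 0 < s := by rw [hs]; positivity
  have hs8 : s ≤ 1 / 8 := by
    have := mul_le_mul_of_nonneg_left hθκ hθ.le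
    have : θ * κ ≤ 1 * κ := by gcongr
    rw [hs]
    linarith
  have hu : 0 < x ^ 2 + k := by positivity
  set u := x ^ 2 + k with hudef
  set ρ := k / u with hρdef
  have hρ0 : 0 ≤ ρ := by positivity
  have hρ1 : ρ ≤ 1 := (div_le_one hu).2 (by rw [hudef]; linarith [sq_nonneg x])
  set α := 2 * x * s / u with hα
  have hψle : ∀ t, |t - x| ≤ 2 → ψ (relIncr x k s t) ≤
      -(1 + 24 * ρ) * relIncr x k s t + (1 / 2 + 24 * ρ) * (α ^ 2 * (t - x) ^ 2) - 24 * ρ * s +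
        522 * θ ^ 3 := by
    intro t ht
    obtain ⟨hb1, hb2⟩ := relIncr_bounds hθ hθ1 hs hk hks ht
    rw [← hudef, ← hα] at hb2
    set q := relIncr x k s t
    have h3 : |q| ^ 3 ≤ (2 * θ) ^ 3 := by gcongr
    have h4 : s * |q| ≤ 2 * θ ^ 3 := by
      have := mul_le_mul_of_nonneg_left hb1 (sq_nonneg θ)
      rw [hs]
      linarith
    have h5 : (1 / 2 + 24 * ρ) * q ^ 2 ≤
        (1 / 2 + 24 * ρ) * (α ^ 2 * (t - x) ^ 2) + 74 * θ ^ 3 := by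
      have := mul_le_mul_of_nonneg_left hb2 (show 0 ≤ 1 / 2 + 24 * ρ by positivity)
      have h6 : ρ * θ ^ 3 ≤ 1 * θ ^ 3 := by gcongr
      have h7 : 0 ≤ θ ^ 3 := by positivity
      linarith
    simp only [hψ]
    linarith
  have hp := hψle 1 (abs_le.2 ⟨by linarith, by linarith⟩)
  have hm := hψle (-1) (abs_le.2 ⟨by linarith, by linarith⟩)
  set v := 1 - 2 * x * g + x ^ 2 with hv
  have hsum := add_le_add
    (mul_le_mul_of_nonneg_left hp (show 0 ≤ (1 + g) / 2 by linarith))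
    (mul_le_mul_of_nonneg_left hm (show 0 ≤ (1 - g) / 2 by linarith))
  have hsu : s / u = ρ * (1 - s) / 8 := by
    rw [hρdef, div_mul_eq_mul_div, hks]; ring
  have hx2u : x ^ 2 / u = 1 - ρ := by
    rw [hρdef, eq_sub_iff_add_eq, ← add_div, ← hudef, div_self hu.ne']
  -- the first moment of the relative increment
  have hq1 : (1 + g) / 2 * relIncr x k s 1 + (1 - g) / 2 * relIncr x k s (-1) =
      2 * s * (x * (g - x) / u) + s * (v * (s / u)) - ρ * s := by
    simp only [relIncr, hρdef, hv, ← hudef]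
    ring
  have hκx : 0 ≤ κ * x ^ 2 := by positivity
  have hx29 : x ^ 2 ≤ 1 / 9 := by
    have := pow_le_pow_left₀ (abs_nonneg x) hx 2
    rw [sq_abs] at this
    linarith
  have hv1 : v ≤ 1 := by linarith [sq_nonneg x]
  have hv0 : 1 / 2 ≤ v := by linarith
  have hdrift : 2 * s * (κ * (1 - ρ)) ≤ 2 * s * (x * (g - x) / u) := by
    rw [← hx2u, ← mul_div_assoc]
    gcongr
  have hvs : s * (ρ * (7 / 128)) ≤ s * (v * (s / u)) := by
    rw [hsu]
    refine mul_le_mul_of_nonneg_left ?_ hs0.le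
    have h1 : ρ * (7 / 8) ≤ ρ * (1 - s) := by gcongr; linarith
    have h2 : 1 / 2 * (ρ * (1 - s) / 8) ≤ v * (ρ * (1 - s) / 8) := by
      refine mul_le_mul_of_nonneg_right hv0 ?_
      have : 0 ≤ ρ * (7 / 8) := by positivity
      linarith
    linarith
  -- the second moment of its leading part
  have hα2 : α ^ 2 * v ≤ s * ((1 - ρ) * ρ / 2) := by
    have e1 : α ^ 2 = 4 * s * ((1 - ρ) * (s / u)) := by
      rw [← hx2u, hα]; field_simp; ring
    have h1 : α ^ 2 * v ≤ α ^ 2 * 1 := mul_le_mul_of_nonneg_left hv1 (sq_nonneg _)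
    have h2 : 0 ≤ s * ((1 - ρ) * ρ * s) := by
      have := sub_nonneg.2 hρ1
      positivity
    rw [e1, hsu] at h1
    rw [e1, hsu]
    linarith
  have hmain := mul_le_mul_of_nonneg_left (main_term_le hκ hκ1 hρ0 hρ1) hs0.le
  have hρ24 : (0 : ℝ) ≤ 1 + 24 * ρ := by positivity
  have hmean := mul_le_mul_of_nonneg_left (add_le_add hdrift hvs) hρ24
  have hvar := mul_le_mul_of_nonneg_left hα2 (show (0 : ℝ) ≤ 1 / 2 + 24 * ρ by positivity)
  have hθ3 : 522 * θ ^ 3 ≤ s * (κ / 2) := by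
    have := mul_le_mul_of_nonneg_left hθκ (sq_nonneg θ)
    rw [hs]
    linarith
  have e2 : (1 + g) / 2 * (α ^ 2 * (1 - x) ^ 2) + (1 - g) / 2 * (α ^ 2 * (-1 - x) ^ 2) =
      α ^ 2 * v := by
    rw [hv]; ring
  refine hsum.trans ?_
  calc _ = -(1 + 24 * ρ) *
          ((1 + g) / 2 * relIncr x k s 1 + (1 - g) / 2 * relIncr x k s (-1)) +
        (1 / 2 + 24 * ρ) * ((1 + g) / 2 * (α ^ 2 * (1 - x) ^ 2) +
          (1 - g) / 2 * (α ^ 2 * (-1 - x) ^ 2)) - 24 * ρ * s + 522 * θ ^ 3 := by ring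
    _ ≤ 0 := by
        rw [hq1, e2]
        linarith

/-- A function of the time and the average that is large when the average is near `0`. For an
unstable equilibrium at `0` the mean of the potential decreases along the process: the logarithm
gains from the repulsion outside the scale `n ^ (-1/2)`, and the second term, which is bounded,
gains from the noise at that scale. -/
noncomputable def potential (n : ℕ) (x : ℝ) : ℝ :=
  -Real.log ((x ^ 2 + 8 / n) / 9) + 24 * (8 / n / (x ^ 2 + 8 / n))

lemma neg_log_le_potential (n : ℕ) (x : ℝ) :
    -Real.log ((x ^ 2 + 8 / n) / 9) ≤ potential n x := by
  have : 0 ≤ 24 * (8 / n / (x ^ 2 + 8 / n)) := by positivity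
  rw [potential]
  linarith

lemma potential_nonneg {n : ℕ} (hn : 1 ≤ n) {x : ℝ} (hx : x ∈ Set.Icc (-1 : ℝ) 1) :
    0 ≤ potential n x := by
  refine le_trans ?_ (neg_log_le_potential n x)
  have hn' : (1 : ℝ) ≤ n := by exact_mod_cast hn
  have h8 : 8 / (n : ℝ) ≤ 8 := div_le_self (by norm_num) hn'
  have hx2 : x ^ 2 ≤ 1 := by nlinarith [hx.1, hx.2]
  rw [neg_nonneg]
  exact Real.log_nonpos (by positivity) (by linarith)

lemma mean_potential_succ_le {κ : ℝ} (hκ : 0 < κ) (hκ1 : κ ≤ 1 / 2) :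
    ∃ N : ℕ, 1 ≤ N ∧ ∀ n : ℕ, N ≤ n → ∀ x g : ℝ, |x| ≤ 1 / 3 → |g| ≤ 1 →
      κ * x ^ 2 ≤ x * (g - x) → x * g ≤ 2 * x ^ 2 →
      (1 + g) / 2 * potential (n + 1) (x + (1 - x) / (n + 1)) +
        (1 - g) / 2 * potential (n + 1) (x + (-1 - x) / (n + 1)) ≤ potential n x := by
  obtain ⟨N, hN⟩ := exists_nat_ge ((1044 / κ) ^ 2)
  refine ⟨N + 1, Nat.le_add_left 1 N, fun n hn x g hx hg hg1 hg2 => ?_⟩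
  have hn0 : (0 : ℝ) < n := by exact_mod_cast (Nat.succ_pos N).trans_le hn
  have hNn : (N : ℝ) ≤ n + 1 := by exact_mod_cast (by omega : N ≤ n + 1)
  set s : ℝ := 1 / (n + 1) with hs
  set k : ℝ := 8 / n with hk
  have hs0 : 0 < s := by positivity
  have hs1 : s ≤ 1 := by rw [hs, div_le_one (by positivity)]; linarith
  have hk0 : 0 < k := by positivity
  have hks : k * (1 - s) = 8 * s := by rw [hk, hs]; field_simp; ring
  have hθ : Real.sqrt s ≤ κ / 1044 := by
    refine Real.sqrt_le_iff.2 ⟨by positivity, ?_⟩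
    rw [hs, div_le_iff₀ (by positivity)]
    have h1 : (κ / 1044) ^ 2 * (1044 / κ) ^ 2 = 1 := by field_simp
    have h2 : (κ / 1044) ^ 2 * (1044 / κ) ^ 2 ≤ (κ / 1044) ^ 2 * (n + 1) := by
      gcongr
      exact hN.trans hNn
    linarith
  have hθs : s = Real.sqrt s ^ 2 := (Real.sq_sqrt hs0.le).symm
  obtain ⟨hx1, hx2⟩ := abs_le.1 hx
  obtain ⟨hga, hgb⟩ := abs_le.1 hg
  have hstep : ∀ t, |t - x| ≤ 2 → potential (n + 1) (x + (t - x) / (n + 1)) ≤ potential n x +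
      (-(1 + 24 * (k / (x ^ 2 + k))) * relIncr x k s t +
      (1 / 2 + 24 * (k / (x ^ 2 + k))) * relIncr x k s t ^ 2 - 24 * (k / (x ^ 2 + k)) * s +
      50 * |relIncr x k s t| ^ 3 + 24 * (s * |relIncr x k s t|)) := by
    intro t ht
    have hb := (relIncr_bounds (Real.sqrt_pos.2 hs0) (by linarith) hθs hk0 hks ht).1
    have hu : x ^ 2 + k ≠ 0 := by positivity
    have h8 : 8 / ((n + 1 : ℕ) : ℝ) = k * (1 - s) := by
      rw [hks, hs]; push_cast; ring
    have hu' : (x + (t - x) / (n + 1)) ^ 2 + k * (1 - s) =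
        (x ^ 2 + k) * (1 + relIncr x k s t) := by
      rw [relIncr, mul_add, mul_one, mul_div_cancel₀ _ hu, div_eq_mul_one_div (t - x), ← hs]
      ring
    rw [potential, h8, hu', potential]
    exact potential_perturb hk0 (by nlinarith [sq_nonneg x]) hs0.le hs1 (by linarith)
  have hp := hstep 1 (abs_le.2 ⟨by linarith, by linarith⟩)
  have hm := hstep (-1) (abs_le.2 ⟨by linarith, by linarith⟩)
  have hmean := mean_potential_perturb_nonpos hκ hκ1 (Real.sqrt_pos.2 hs0) hθ hθs hk0 hks hx hg
    hg1 hg2 rfl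
  have hsum := add_le_add
    (mul_le_mul_of_nonneg_left hp (show 0 ≤ (1 + g) / 2 by linarith))
    (mul_le_mul_of_nonneg_left hm (show 0 ≤ (1 - g) / 2 by linarith))
  refine hsum.trans ?_
  linarith

/-! ### The unstable equilibrium is not a limit -/

open Classical in
/-- The potential, killed when the average has left `[-ε, ε]` after time `m` and before time
`n`. -/
noncomputable def killedPotential (ε : ℝ) (m n : ℕ) (z : ℕ → ℝ) : ℝ :=
  if ∀ j ∈ Set.Ico m n, |avg z j| ≤ ε then potential n (avg z n) else 0

lemma dependsOn_forall_avg (ε : ℝ) (m : ℕ) {n N : ℕ} (hn : n ≤ N + 1) :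
    DependsOn (fun z => ∀ j ∈ Set.Ico m n, |avg z j| ≤ ε) (Set.Iio N) := by
  intro x y hxy
  refine propext (forall₂_congr fun j hj => ?_)
  rw [show avg x j = avg y j from dependsOn_avg (by have := hj.2; omega) hxy]

lemma dependsOn_killedPotential (ε : ℝ) (m n : ℕ) :
    DependsOn (killedPotential ε m n) (Set.Iio n) := by
  intro x y hxy
  have h1 := dependsOn_forall_avg ε m n.le_succ hxy
  have h2 := dependsOn_avg le_rfl hxy
  classical
  exact if_congr (iff_of_eq h1) (congrArg (potential n) h2) rfl

lemma tendsto_potential {x : ℕ → ℝ} (hx : Tendsto x atTop (𝓝 0)) :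
    Tendsto (fun n => potential n (x n)) atTop atTop := by
  refine tendsto_atTop_mono' atTop (Eventually.of_forall fun n => neg_log_le_potential n (x n)) ?_
  refine tendsto_neg_atBot_atTop.comp (Real.tendsto_log_nhdsGT_zero.comp ?_)
  refine tendsto_nhdsWithin_iff.2 ⟨?_, ?_⟩
  · have h := ((hx.pow 2).add (tendsto_const_div_atTop_nhds_zero_nat 8)).div_const 9
    simpa using h
  · filter_upwards [eventually_gt_atTop 0] with n hn
    have : (0 : ℝ) < n := by exact_mod_cast hn
    exact Set.mem_Ioi.2 (by positivity)

namespace IsStepProcess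

variable {g : ℝ → ℝ} {M : ℕ} {Ω : Type u} [MeasurableSpace Ω] {μ : Measure Ω} {X : ℕ → Ω → ℝ}

lemma killedPotential_nonneg (hX : IsStepProcess g M μ X) (ε : ℝ) (m : ℕ) {n : ℕ} (hn : 1 ≤ n)
    (ω : Ω) : 0 ≤ killedPotential ε m n (X · ω) := by
  rw [killedPotential]
  split_ifs
  · exact potential_nonneg hn (hX.avg_mem n ω)
  · exact le_rfl

lemma integral_killedPotential_succ_le [IsProbabilityMeasure μ] (hX : IsStepProcess g M μ X)
    {ε : ℝ} {m n : ℕ} (hMn : M ≤ n) (hn1 : 1 ≤ n) (hmn : m ≤ n)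
    (hstep : ∀ x ∈ Set.Icc (-1 : ℝ) 1, |x| ≤ ε →
      (1 + g x) / 2 * potential (n + 1) (x + (1 - x) / (n + 1)) +
        (1 - g x) / 2 * potential (n + 1) (x + (-1 - x) / (n + 1)) ≤ potential n x) :
    ∫ ω, killedPotential ε m (n + 1) (X · ω) ∂μ ≤ ∫ ω, killedPotential ε m n (X · ω) ∂μ := by
  classical
  set F : (ℕ → ℝ) → ℝ → ℝ := fun z t => if ∀ j ∈ Set.Ico m (n + 1), |avg z j| ≤ ε then
    potential (n + 1) (avg z n + (t - avg z n) / (n + 1)) else 0 with hF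
  have hdep : ∀ t, DependsOn (fun z => F z t) (Set.Iio n) := by
    intro t x y hxy
    have h1 := dependsOn_forall_avg ε m (le_refl (n + 1)) hxy
    have h2 := dependsOn_avg le_rfl hxy
    simp only at h1 h2
    simp only [hF, h1, h2]
  have e : ∀ z : ℕ → ℝ, killedPotential ε m (n + 1) z = F z (z n) := fun z => by
    simp only [killedPotential, hF, avg_succ]
  simp only [e]
  rw [hX.integral_step hMn hdep]
  refine integral_mono (hX.integrable_apply (dependsOn_mean g hdep))
    (hX.integrable_apply (dependsOn_killedPotential ε m n)) fun ω => ?_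
  simp only
  by_cases hin : ∀ j ∈ Set.Ico m (n + 1), |avg (X · ω) j| ≤ ε
  · have hin' : ∀ j ∈ Set.Ico m n, |avg (X · ω) j| ≤ ε := fun j hj =>
      hin j ⟨hj.1, Nat.lt_succ_of_lt hj.2⟩
    simp only [hF, killedPotential, if_pos hin, if_pos hin']
    exact hstep _ (hX.avg_mem n ω) (hin n ⟨hmn, Nat.lt_succ_self n⟩)
  · simp only [hF, if_neg hin, mul_zero, add_zero]
    exact hX.killedPotential_nonneg ε m hn1 ω

/-- If the drift pushes away from `0` at a linear rate, the averages do not tend to `0`: on that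
event the killed potential would tend to infinity, while its mean is bounded. -/
lemma measure_limitEvent_zero [IsProbabilityMeasure μ] (hX : IsStepProcess g M μ X)
    {κ ε : ℝ} (hκ : 0 < κ) (hκ1 : κ ≤ 1 / 2) (hε : 0 < ε) (hε1 : ε ≤ 1 / 3)
    (hg1 : ∀ x, |x| ≤ ε → κ * x ^ 2 ≤ x * (g x - x))
    (hg2 : ∀ x, |x| ≤ ε → x * g x ≤ 2 * x ^ 2) : μ (limitEvent X 0) = 0 := by
  obtain ⟨N, hN1, hN⟩ := mean_potential_succ_le hκ hκ1
  have hcover : limitEvent X 0 ⊆ ⋃ k : ℕ, {ω | Tendsto (avg (X · ω)) atTop (𝓝 0) ∧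
      ∀ j, max k (max M N) ≤ j → |avg (X · ω) j| ≤ ε} := by
    intro ω hω
    have hω' : Tendsto (avg (X · ω)) atTop (𝓝 0) := hω
    obtain ⟨k, hk⟩ := eventually_atTop.1 (hω'.eventually (Metric.closedBall_mem_nhds 0 hε))
    refine Set.mem_iUnion.2 ⟨k, hω', fun j hj => ?_⟩
    simpa using hk j ((le_max_left _ _).trans hj)
  refine measure_mono_null hcover (measure_iUnion_null fun k => ?_)
  set m := max k (max M N) with hm
  have hMm : M ≤ m := (le_max_left _ _).trans (le_max_right _ _)
  have hNm : N ≤ m := (le_max_right _ _).trans (le_max_right _ _)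
  have hbound : ∀ n, m ≤ n → ∫ ω, killedPotential ε m n (X · ω) ∂μ ≤
      ∫ ω, killedPotential ε m m (X · ω) ∂μ := by
    intro n hn
    induction n, hn using Nat.le_induction with
    | base => exact le_rfl
    | succ n hn ih =>
      refine le_trans ?_ ih
      exact hX.integral_killedPotential_succ_le (hMm.trans hn) (hN1.trans (hNm.trans hn)) hn
        fun x hx hxε => hN n (hNm.trans hn) x (g x) (hxε.trans hε1)
          (abs_le.2 (hX.mean_mem x hx)) (hg1 x hxε) (hg2 x hxε)
  have hmeas : ∀ n, Measurable fun ω => ENNReal.ofReal (killedPotential ε m n (X · ω)) :=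
    fun n => (hX.measurable_apply (dependsOn_killedPotential ε m n)).ennreal_ofReal
  have hfatou : ∫⁻ ω, liminf (fun n => ENNReal.ofReal (killedPotential ε m n (X · ω))) atTop ∂μ
      ≠ ⊤ := by
    refine ne_top_of_le_ne_top (ENNReal.ofReal_ne_top
      (r := ∫ ω, killedPotential ε m m (X · ω) ∂μ)) ((lintegral_liminf_le hmeas).trans ?_)
    refine liminf_le_of_frequently_le' (Eventually.frequently ?_)
    filter_upwards [eventually_ge_atTop m] with n hn
    rw [← ofReal_integral_eq_lintegral_ofReal
      (hX.integrable_apply (dependsOn_killedPotential ε m n))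
      (Eventually.of_forall fun ω => hX.killedPotential_nonneg ε m (hN1.trans (hNm.trans hn)) ω)]
    exact ENNReal.ofReal_le_ofReal (hbound n hn)
  refine measure_mono_null ?_ (ae_iff.1 (ae_lt_top (Measurable.liminf hmeas) hfatou))
  rintro ω ⟨hω, hstay⟩
  have htop : Tendsto (fun n => ENNReal.ofReal (killedPotential ε m n (X · ω))) atTop (𝓝 ⊤) := by
    refine ENNReal.tendsto_ofReal_atTop.comp ((tendsto_potential hω).congr fun n => ?_)
    rw [killedPotential, if_pos fun j hj => hstay j hj.1]
  simp [htop.liminf_eq]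

/-! ### Long runs of positive steps -/

lemma measurableSet_run (hX : IsStepProcess g M μ X) (n : ℕ) :
    MeasurableSet {ω | ∀ j ∈ Set.Ico M n, X j ω = 1} := by
  have : {ω | ∀ j ∈ Set.Ico M n, X j ω = 1} = ⋂ j ∈ Set.Ico M n, X j ⁻¹' {1} := by
    ext ω
    simp
  rw [this]
  exact MeasurableSet.biInter (Set.to_countable _) fun j _ =>
    hX.measurable j (measurableSet_singleton 1)

/-- If every step is positive with probability at least `c > 0`, a run of positive steps has
positive probability. -/
lemma real_run_pos [IsProbabilityMeasure μ] (hX : IsStepProcess g M μ X) {c : ℝ} (hc : 0 < c)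
    (hg : ∀ x ∈ Set.Icc (-1 : ℝ) 1, c ≤ (1 + g x) / 2) {n : ℕ} (hn : M ≤ n) :
    0 < μ.real {ω | ∀ j ∈ Set.Ico M n, X j ω = 1} := by
  classical
  set f : ℕ → (ℕ → ℝ) → ℝ := fun n z => if ∀ j ∈ Set.Ico M n, z j = 1 then 1 else 0 with hf
  have hdep : ∀ n, DependsOn (f n) (Set.Iio n) := by
    intro n x y hxy
    have : (∀ j ∈ Set.Ico M n, x j = 1) ↔ ∀ j ∈ Set.Ico M n, y j = 1 :=
      forall₂_congr fun j hj => by rw [hxy j hj.2]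
    simp only [hf, this]
  have hreal : ∀ n, μ.real {ω | ∀ j ∈ Set.Ico M n, X j ω = 1} = ∫ ω, f n (X · ω) ∂μ := by
    intro n
    rw [← integral_indicator_one (hX.measurableSet_run n)]
    congr 1
  rw [hreal]
  induction n, hn using Nat.le_induction with
  | base =>
    have h1 : ∀ z, f M z = 1 := fun z => if_pos fun j hj => absurd hj.2 (not_lt.2 hj.1)
    simp [h1]
  | succ n hn ih =>
    refine (mul_pos hc ih).trans_le ?_
    set F : (ℕ → ℝ) → ℝ → ℝ := fun z t => if t = 1 then f n z else 0 with hF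
    have hFdep : ∀ t, DependsOn (fun z => F z t) (Set.Iio n) := by
      intro t x y hxy
      simp only [hF, hdep n hxy]
    have e : ∀ z : ℕ → ℝ, f (n + 1) z = F z (z n) := by
      intro z
      have : (∀ j ∈ Set.Ico M (n + 1), z j = 1) ↔ z n = 1 ∧ ∀ j ∈ Set.Ico M n, z j = 1 := by
        refine ⟨fun h => ⟨h n ⟨hn, Nat.lt_succ_self n⟩, fun j hj => h j ⟨hj.1, hj.2.trans
          (Nat.lt_succ_self n)⟩⟩, fun h j hj => ?_⟩
        rcases Nat.lt_succ_iff_lt_or_eq.1 hj.2 with hlt | rfl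
        · exact h.2 j ⟨hj.1, hlt⟩
        · exact h.1
      simp only [hf, hF, this, ite_and]
    simp only [e]
    rw [hX.integral_step hn hFdep, ← integral_const_mul]
    refine integral_mono ((hX.integrable_apply (hdep n)).const_mul c)
      (hX.integrable_apply (dependsOn_mean g hFdep)) fun ω => ?_
    have h0 : 0 ≤ f n (X · ω) := by simp only [hf]; split_ifs <;> norm_num
    have h1 : ¬ (-1 : ℝ) = 1 := by norm_num
    simp only [hF, if_true, if_neg h1, mul_zero, add_zero]
    exact mul_le_mul_of_nonneg_right (hg _ (hX.avg_mem n ω)) h0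

/-- After a run of positive steps of three times the length of the past, the average is at least
`1 / 2`. -/
lemma half_le_avg_of_run (hX : IsStepProcess g M μ X) (hM : 1 ≤ M) {ω : Ω}
    (h : ∀ j ∈ Set.Ico M (4 * M), X j ω = 1) : 1 / 2 ≤ avg (X · ω) (4 * M) := by
  have hM' : (0 : ℝ) < M := by exact_mod_cast hM
  have h1 : ∑ j ∈ Finset.range M, (-1 : ℝ) ≤ ∑ j ∈ Finset.range M, X j ω :=
    Finset.sum_le_sum fun j _ => by rcases hX.step_eq j ω with h | h <;> rw [h]; norm_num
  have h2 : ∑ j ∈ Finset.Ico M (4 * M), X j ω = ∑ j ∈ Finset.Ico M (4 * M), (1 : ℝ) :=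
    Finset.sum_congr rfl fun j hj => h j (by simpa using hj)
  have h3 := Finset.sum_range_add_sum_Ico (fun j => X j ω) (show M ≤ 4 * M by omega)
  simp only [Finset.sum_const, Finset.card_range, Nat.card_Ico, nsmul_eq_mul] at h1 h2
  rw [Nat.cast_sub (by omega)] at h2
  push_cast at h2
  rw [avg, le_div_iff₀ (by positivity), ← h3, h2]
  push_cast
  linarith

end IsStepProcess

/-! ### Crossings of the diagonal -/

lemma isDownCrossing_of_factor {f h : ℝ → ℝ} {y₀ : ℝ} (hf : ∀ y, f y - y = (y - y₀) * h y)
    (hh : Continuous h) (h0 : h y₀ < 0) : IsDownCrossing f y₀ := by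
  have hev : ∀ᶠ y in 𝓝 y₀, h y < 0 := hh.continuousAt.eventually_lt_const h0
  refine ⟨by have := hf y₀; rw [sub_self, zero_mul] at this; linarith, ?_, ?_⟩
  · filter_upwards [hev.filter_mono nhdsWithin_le_nhds, self_mem_nhdsWithin] with y h1 h2
    have := mul_pos_of_neg_of_neg (sub_neg.2 (Set.mem_Iio.1 h2)) h1
    linarith [hf y]
  · filter_upwards [hev.filter_mono nhdsWithin_le_nhds, self_mem_nhdsWithin] with y h1 h2
    have := mul_neg_of_pos_of_neg (sub_pos.2 (Set.mem_Ioi.1 h2)) h1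
    linarith [hf y]

lemma isUpCrossing_of_factor {f h : ℝ → ℝ} {y₀ : ℝ} (hf : ∀ y, f y - y = (y - y₀) * h y)
    (hh : Continuous h) (h0 : 0 < h y₀) : IsUpCrossing f y₀ := by
  have hev : ∀ᶠ y in 𝓝 y₀, 0 < h y := hh.continuousAt.eventually_const_lt h0
  refine ⟨by have := hf y₀; rw [sub_self, zero_mul] at this; linarith, ?_, ?_⟩
  · filter_upwards [hev.filter_mono nhdsWithin_le_nhds, self_mem_nhdsWithin] with y h1 h2
    have := mul_neg_of_neg_of_pos (sub_neg.2 (Set.mem_Iio.1 h2)) h1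
    linarith [hf y]
  · filter_upwards [hev.filter_mono nhdsWithin_le_nhds, self_mem_nhdsWithin] with y h1 h2
    have := mul_pos (sub_pos.2 (Set.mem_Ioi.1 h2)) h1
    linarith [hf y]

lemma urnFunction_sub_self (p : ℝ) (k : ℕ) (y : ℝ) :
    urnFunction p k y - y = (stepMean p k (2 * y - 1) - (2 * y - 1)) / 2 := by
  rw [stepMean]
  ring_nf

lemma stepMean_one_sub_self (p x : ℝ) : stepMean p 1 x - x = x * (2 * p - 2) := by
  rw [stepMean_one]
  ring

lemma stepMean_three_sub_self (p x : ℝ) :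
    stepMean p 3 x - x = x * ((2 * p - 1) * (3 - x ^ 2) / 2 - 1) := by
  rw [stepMean_three]
  ring

lemma continuous_stepMean_three (p : ℝ) : Continuous (stepMean p 3) := by
  rw [show stepMean p 3 = fun x => (2 * p - 1) * (3 * x - x ^ 3) / 2 from
    funext (stepMean_three p)]
  fun_prop

lemma stepMean_three_neg (p x : ℝ) : stepMean p 3 (-x) = -stepMean p 3 x := by
  rw [stepMean_three, stepMean_three]
  ring

lemma dense_stepMean_three_ne (p : ℝ) : Dense {c | stepMean p 3 c ≠ c} := by
  set A := 3 * (2 * p - 1) / 2 - 1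
  set B := (2 * p - 1) / 2
  have hfin : {c | stepMean p 3 c = c}.Finite := by
    refine Set.Finite.subset (Set.toFinite {0, Real.sqrt (A / B), -Real.sqrt (A / B)}) ?_
    intro c hc
    have h : c * (A - B * c ^ 2) = 0 := by
      have := stepMean_three_sub_self p c
      rw [show stepMean p 3 c = c from hc, sub_self] at this
      rw [this]
      simp only [A, B]
      ring
    rcases mul_eq_zero.1 h with h0 | h0
    · exact Or.inl h0
    · right
      have hB : B ≠ 0 := by
        intro hB
        have hA : A = 3 * B - 1 := by simp only [A, B]; ring
        rw [hA, hB] at h0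
        norm_num at h0
      have hsq : A / B = c ^ 2 := by rw [div_eq_iff hB]; linarith
      rw [hsq, Real.sqrt_sq_eq_abs]
      rcases abs_choice c with h | h
      · exact Or.inl h.symm
      · exact Or.inr (by rw [h]; simp)
  have := hfin.countable.dense_compl ℝ
  exact this

/-! ### The subcritical regime -/

/-- A factorization `stepMean p k x - x = x * h x` with `h < 0` makes `0` the only possible limit
and `1 / 2` the only fixed point of the urn function. -/
lemma subcritical_of_factor {p : ℝ} {k : ℕ} (h0 : 0 ≤ p) (h1 : p ≤ 1) (hk : Odd k) {h : ℝ → ℝ}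
    (hf : ∀ x, stepMean p k x - x = x * h x) (hh : Continuous h)
    (hneg : ∀ x ∈ Set.Icc (-1 : ℝ) 1, h x < 0) (hc : Continuous (stepMean p k))
    (hd : Dense {c | stepMean p k c ≠ c}) :
    {y ∈ Set.Icc (0 : ℝ) 1 | urnFunction p k y = y} = {1 / 2} ∧
      IsDownCrossing (urnFunction p k) (1 / 2) ∧
      ∀ (M : ℕ) (xM : ℝ) (Ω : Type u) [MeasurableSpace Ω] (μ : Measure Ω)
        [IsProbabilityMeasure μ] (X : ℕ → Ω → ℝ), 1 ≤ M → IsERW p k M xM μ X →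
        ∀ᵐ ω ∂μ, ω ∈ limitEvent X 0 := by
  have hfac : ∀ y, urnFunction p k y - y = (y - 1 / 2) * h (2 * y - 1) := fun y => by
    rw [urnFunction_sub_self, hf]
    ring
  refine ⟨?_, ?_, ?_⟩
  · ext y
    simp only [Set.mem_ofPred_eq, Set.mem_singleton_iff]
    constructor
    · rintro ⟨hy, he⟩
      have h2 := hneg (2 * y - 1) ⟨by linarith [hy.1], by linarith [hy.2]⟩
      have h3 := hfac y
      rw [he, sub_self] at h3
      rcases mul_eq_zero.1 h3.symm with h4 | h4
      · linarith
      · exact absurd h4 h2.ne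
    · rintro rfl
      refine ⟨by norm_num, ?_⟩
      have := hfac (1 / 2)
      rw [sub_self, zero_mul] at this
      linarith
  · refine isDownCrossing_of_factor hfac (hh.comp (by fun_prop)) ?_
    exact hneg _ (by norm_num)
  · intro M xM Ω _ μ _ X hM hX
    filter_upwards [(hX.isStepProcess h0 h1 hk hM).ae_exists_tendsto_avg hc hd] with ω hω
    obtain ⟨l, hl, hlim, hfix⟩ := hω
    have h3 := hf l
    rw [hfix, sub_self] at h3
    rcases mul_eq_zero.1 h3.symm with rfl | h4
    · exact hlim
    · exact absurd h4 (hneg l hl).ne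

lemma subcritical {p : ℝ} {k : ℕ} (h0 : 0 ≤ p) (h : k = 1 ∧ p < 1 ∨ k = 3 ∧ p < 5 / 6) :
    {y ∈ Set.Icc (0 : ℝ) 1 | urnFunction p k y = y} = {1 / 2} ∧
      IsDownCrossing (urnFunction p k) (1 / 2) ∧
      ∀ (M : ℕ) (xM : ℝ) (Ω : Type u) [MeasurableSpace Ω] (μ : Measure Ω)
        [IsProbabilityMeasure μ] (X : ℕ → Ω → ℝ), 1 ≤ M → IsERW p k M xM μ X →
        ∀ᵐ ω ∂μ, ω ∈ limitEvent X 0 := by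
  rcases h with ⟨rfl, hp⟩ | ⟨rfl, hp⟩
  · refine subcritical_of_factor h0 hp.le odd_one (h := fun _ => 2 * p - 2)
      (stepMean_one_sub_self p) continuous_const (fun x _ => by linarith) ?_ ?_
    · rw [show stepMean p 1 = fun x => (2 * p - 1) * x from funext (stepMean_one p)]
      fun_prop
    · have hd : Dense ({0}ᶜ : Set ℝ) := (Set.countable_singleton 0).dense_compl ℝ
      refine hd.mono ?_
      intro c hc hcc
      refine hc ?_
      have := stepMean_one_sub_self p c
      rw [show stepMean p 1 c = c from hcc, sub_self] at this
      exact (mul_eq_zero.1 this.symm).resolve_right (by linarith)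
  · refine subcritical_of_factor h0 (by linarith) (by decide)
      (h := fun x => (2 * p - 1) * (3 - x ^ 2) / 2 - 1)
      (stepMean_three_sub_self p) (by fun_prop) (fun x hx => ?_) (continuous_stepMean_three p)
      (dense_stepMean_three_ne p)
    have hx2 : x ^ 2 ≤ 1 := by nlinarith [hx.1, hx.2]
    rcases le_or_gt 0 (2 * p - 1) with hs | hs
    · nlinarith [mul_nonneg hs (sq_nonneg x)]
    · nlinarith

/-! ### The supercritical regime -/

section Supercritical

variable {p : ℝ}

lemma xPlus_sq (hp : 5 / 6 < p) : (2 * p - 1) * xPlus p ^ 2 = 6 * p - 5 := by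
  rw [xPlus, Real.sq_sqrt (div_nonneg (by linarith) (by linarith)),
    mul_div_cancel₀ _ (by linarith : 2 * p - 1 ≠ 0)]

lemma xPlus_pos (hp : 5 / 6 < p) : 0 < xPlus p :=
  Real.sqrt_pos.2 (div_pos (by linarith) (by linarith))

lemma xMinus_eq (p : ℝ) : xMinus p = -xPlus p := rfl

lemma xPlus_le_one (hp : 5 / 6 < p) (hp1 : p ≤ 1) : xPlus p ≤ 1 := by
  refine Real.sqrt_le_iff.2 ⟨zero_le_one, ?_⟩
  rw [one_pow, div_le_one (by linarith)]
  linarith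

lemma stepMean_three_sub_self_factor (hp : 5 / 6 < p) (x : ℝ) :
    stepMean p 3 x - x = -(2 * p - 1) / 2 * x * (x - xPlus p) * (x + xPlus p) := by
  rw [stepMean_three_sub_self]
  have := xPlus_sq hp
  linear_combination -x / 2 * this

lemma eq_of_stepMean_three_eq (hp : 5 / 6 < p) {x : ℝ} (h : stepMean p 3 x = x) :
    x = 0 ∨ x = xMinus p ∨ x = xPlus p := by
  have h1 := stepMean_three_sub_self_factor hp x
  rw [h, sub_self, eq_comm, mul_eq_zero, mul_eq_zero, mul_eq_zero] at h1
  rcases h1 with ((h2 | h2) | h2) | h2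
  · linarith
  · exact Or.inl h2
  · exact Or.inr (Or.inr (by linarith))
  · exact Or.inr (Or.inl (by rw [xMinus_eq]; linarith))

lemma fixedPoints_three (hp : 5 / 6 < p) (hp1 : p ≤ 1) :
    {y ∈ Set.Icc (0 : ℝ) 1 | urnFunction p 3 y = y} =
      {1 / 2, (1 + xMinus p) / 2, (1 + xPlus p) / 2} := by
  have hs0 := xPlus_pos hp
  have hs1 := xPlus_le_one hp hp1
  ext y
  simp only [Set.mem_ofPred_eq, Set.mem_insert_iff, Set.mem_singleton_iff]
  have hfix : urnFunction p 3 y = y ↔ stepMean p 3 (2 * y - 1) = 2 * y - 1 := by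
    have := urnFunction_sub_self p 3 y
    constructor <;> intro h <;> linarith
  rw [hfix]
  constructor
  · rintro ⟨-, h⟩
    rcases eq_of_stepMean_three_eq hp h with h | h | h
    · exact Or.inl (by linarith)
    · exact Or.inr (Or.inl (by linarith))
    · exact Or.inr (Or.inr (by linarith))
  · rw [← sub_eq_zero (a := stepMean p 3 _), stepMean_three_sub_self_factor hp, xMinus_eq]
    rintro (rfl | rfl | rfl)
    · norm_num
    · exact ⟨⟨by linarith, by linarith⟩, by ring⟩
    · exact ⟨⟨by linarith, by linarith⟩, by ring⟩

lemma isUpCrossing_three (hp : 5 / 6 < p) : IsUpCrossing (urnFunction p 3) (1 / 2) := by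
  refine isUpCrossing_of_factor
    (h := fun y => (2 * p - 1) * (3 - (2 * y - 1) ^ 2) / 2 - 1) (fun y => ?_) (by fun_prop) ?_
  · rw [urnFunction_sub_self, stepMean_three_sub_self]
    ring
  · norm_num
    linarith

lemma isDownCrossing_three_xMinus (hp : 5 / 6 < p) :
    IsDownCrossing (urnFunction p 3) ((1 + xMinus p) / 2) := by
  refine isDownCrossing_of_factor
    (h := fun y => -(2 * p - 1) / 2 * (2 * y - 1) * (2 * y - 1 - xPlus p)) (fun y => ?_)
    (by fun_prop) ?_
  · rw [urnFunction_sub_self, stepMean_three_sub_self_factor hp, xMinus_eq]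
    ring
  · have h := mul_pos (show 0 < 2 * p - 1 by linarith) (pow_pos (xPlus_pos hp) 2)
    rw [xMinus_eq]
    linarith

lemma isDownCrossing_three_xPlus (hp : 5 / 6 < p) :
    IsDownCrossing (urnFunction p 3) ((1 + xPlus p) / 2) := by
  refine isDownCrossing_of_factor
    (h := fun y => -(2 * p - 1) / 2 * (2 * y - 1) * (2 * y - 1 + xPlus p)) (fun y => ?_)
    (by fun_prop) ?_
  · rw [urnFunction_sub_self, stepMean_three_sub_self_factor hp]
    ring
  · have h := mul_pos (show 0 < 2 * p - 1 by linarith) (pow_pos (xPlus_pos hp) 2)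
    linarith

lemma avg_neg (z : ℕ → ℝ) (n : ℕ) : avg (fun i => -z i) n = -avg z n := by
  simp [avg, neg_div]

lemma limitEvent_neg {Ω : Type u} (X : ℕ → Ω → ℝ) (l : ℝ) :
    limitEvent (fun n ω => -X n ω) (-l) = limitEvent X l := by
  ext ω
  simp only [limitEvent, Set.mem_ofPred_eq, avg_neg]
  exact tendsto_neg_iff

variable {M : ℕ} {Ω : Type u} [MeasurableSpace Ω] {μ : Measure Ω} {X : ℕ → Ω → ℝ}

/-- The limit is a zero of the drift, and the zero at the origin is excluded as the drift grows there
like `A * x` with `A = 3 * p - 5 / 2 > 0`. -/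
lemma IsStepProcess.ae_limit_three [IsProbabilityMeasure μ] (hp : 5 / 6 < p) (hp1 : p ≤ 1)
    (hX : IsStepProcess (stepMean p 3) M μ X) :
    ∀ᵐ ω ∂μ, ω ∈ limitEvent X (xMinus p) ∨ ω ∈ limitEvent X (xPlus p) := by
  set A := 3 * (2 * p - 1) / 2 - 1 with hA
  have hA0 : 0 < A := by linarith
  have hfac : ∀ x, x * (stepMean p 3 x - x) = x ^ 2 * (A - (2 * p - 1) / 2 * x ^ 2) := fun x => by
    rw [stepMean_three_sub_self, hA]
    ring
  have hzero : μ (limitEvent X 0) = 0 := by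
    refine hX.measure_limitEvent_zero (κ := A / 2) (ε := min (1 / 3) A) (by positivity)
      (by linarith) (by positivity) (min_le_left _ _) (fun x hx => ?_) (fun x hx => ?_)
    · rw [hfac]
      have h1 : |x| ≤ 1 / 3 := hx.trans (min_le_left _ _)
      have h2 : |x| ≤ A := hx.trans (min_le_right _ _)
      have h3 : x ^ 2 ≤ A := by
        rw [← sq_abs]
        nlinarith [abs_nonneg x]
      have h4 : (2 * p - 1) / 2 * x ^ 2 ≤ 1 / 2 * x ^ 2 := by gcongr; linarith
      nlinarith [sq_nonneg x]
    · have h1 := hfac x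
      have h2 : 0 ≤ x ^ 2 * ((2 * p - 1) / 2 * x ^ 2) :=
        mul_nonneg (sq_nonneg x) (mul_nonneg (by linarith) (sq_nonneg x))
      have h3 : x ^ 2 * A ≤ x ^ 2 * 1 := mul_le_mul_of_nonneg_left (by linarith) (sq_nonneg x)
      nlinarith
  filter_upwards [hX.ae_exists_tendsto_avg (continuous_stepMean_three p)
    (dense_stepMean_three_ne p), measure_eq_zero_iff_ae_notMem.1 hzero] with ω ⟨l, _, hl, hfix⟩ h0
  rcases eq_of_stepMean_three_eq hp hfix with rfl | rfl | rfl
  · exact absurd hl h0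
  · exact Or.inl hl
  · exact Or.inr hl

/-- The exponential bound, with a rate that depends only on `p` and the initial level `δ`. -/
lemma exists_rate_three (hp : 5 / 6 < p) {δ : ℝ} (hδ : 0 < δ) :
    ∃ c : ℝ, 0 < c ∧ ∀ (M : ℕ) (Ω : Type u) [MeasurableSpace Ω] (μ : Measure Ω)
      [IsProbabilityMeasure μ] (X : ℕ → Ω → ℝ), 1 ≤ M → IsStepProcess (stepMean p 3) M μ X →
      (∀ᵐ ω ∂μ, δ ≤ avg (X · ω) M) →
      μ.real (limitEvent X (xMinus p)) ≤ Real.exp (-c * M) := by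
  have hs0 := xPlus_pos hp
  -- a level between `0` and both `δ` and `xPlus p`
  set a := min δ (xPlus p) / 2 with ha
  have ha0 : 0 < a := by positivity
  have haδ : a < δ := by have := min_le_left δ (xPlus p); linarith
  have has : a < xPlus p := by have := min_le_right δ (xPlus p); linarith
  have hga : a < stepMean p 3 a := by
    have h1 := stepMean_three_sub_self_factor hp a
    have h2 : 0 < (2 * p - 1) / 2 * a * (xPlus p - a) * (a + xPlus p) :=
      mul_pos (mul_pos (mul_pos (by linarith) ha0) (sub_pos.2 has)) (by linarith)
    linarith
  obtain ⟨r, hr, hrate⟩ := exists_rate hga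
  refine ⟨r * (δ - a), mul_pos hr (sub_pos.2 haδ), fun M Ω _ μ _ X hM hX hδM => ?_⟩
  refine hX.real_limitEvent_le hr hrate (fun x hx => ?_) hM hδM (by rw [xMinus_eq]; linarith)
  -- the conditional mean is increasing on `[a, 1]`
  have e : stepMean p 3 x - stepMean p 3 a =
      (2 * p - 1) / 2 * ((x - a) * (3 - x ^ 2 - x * a - a ^ 2)) := by
    rw [stepMean_three, stepMean_three]
    ring
  have h1 : 0 ≤ 3 - x ^ 2 - x * a - a ^ 2 := by nlinarith [hx.1, hx.2]
  have h2 := mul_nonneg (show 0 ≤ (2 * p - 1) / 2 by linarith)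
    (mul_nonneg (sub_nonneg.2 hx.1) h1)
  linarith

/-- Conditionally on a run of positive steps up to time `4 * M`, the walk starts above `1 / 2`, and the
other limit has probability less than `1`. -/
lemma IsStepProcess.measure_limitEvent_xPlus_pos [IsProbabilityMeasure μ] (hp : 5 / 6 < p)
    (hp1 : p < 1) (hM : 1 ≤ M) (hX : IsStepProcess (stepMean p 3) M μ X) :
    0 < μ (limitEvent X (xPlus p)) := by
  have hup : ∀ x ∈ Set.Icc (-1 : ℝ) 1, 1 - p ≤ (1 + stepMean p 3 x) / 2 := by
    intro x hx
    have e : (1 + stepMean p 3 x) / 2 - (1 - p) = (2 * p - 1) / 4 * ((1 + x) ^ 2 * (2 - x)) := by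
      rw [stepMean_three]
      ring
    have := mul_nonneg (show 0 ≤ (2 * p - 1) / 4 by linarith)
      (mul_nonneg (sq_nonneg (1 + x)) (show 0 ≤ 2 - x by linarith [hx.2]))
    linarith
  have hMN : M ≤ 4 * M := by omega
  have hrun := hX.real_run_pos (sub_pos.2 hp1) hup hMN
  set E : Set (ℕ → ℝ) := {z | ∀ j ∈ Set.Ico M (4 * M), z j = 1}
  have hE0 : μ {ω | (X · ω) ∈ E} ≠ 0 := fun h0 => by
    have h1 : μ.real {ω | (X · ω) ∈ E} = 0 := by rw [measureReal_def, h0]; rfl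
    exact hrun.ne' h1
  have hEdep : DependsOn (· ∈ E) (Set.Iio (4 * M)) := fun x y hxy =>
    propext (forall₂_congr fun j hj => by rw [hxy j hj.2])
  have hEm : MeasurableSet {ω | (X · ω) ∈ E} := hX.measurableSet_run (4 * M)
  have hcond := hX.cond hMN hEdep
  set ν := ProbabilityTheory.cond μ {ω | (X · ω) ∈ E}
  have : IsProbabilityMeasure ν := ProbabilityTheory.cond_isProbabilityMeasure hE0
  obtain ⟨c, hc, hbound⟩ := exists_rate_three.{u} hp (δ := 1 / 2) (by norm_num)
  have hlt : ν.real (limitEvent X (xMinus p)) < 1 := by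
    refine (hbound (4 * M) Ω ν X (by omega) hcond ?_).trans_lt (Real.exp_lt_one_iff.2 ?_)
    · filter_upwards [ProbabilityTheory.ae_cond_mem hEm] with ω hω
      exact hX.half_le_avg_of_run hM hω
    · have : (0 : ℝ) < (4 * M : ℕ) := by exact_mod_cast (by omega : 0 < 4 * M)
      have := mul_pos hc this
      linarith
  have hνpos : ν (limitEvent X (xPlus p)) ≠ 0 := by
    intro h0
    have hae : ∀ᵐ ω ∂ν, ω ∈ limitEvent X (xMinus p) := by
      filter_upwards [hcond.ae_limit_three hp hp1.le, measure_eq_zero_iff_ae_notMem.1 h0]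
        with ω h1 h2
      exact h1.resolve_right h2
    have h1 : ν (limitEvent X (xMinus p)) = 1 := by
      rw [← measure_univ (μ := ν)]
      exact measure_congr (eventuallyEq_univ.2 hae)
    rw [measureReal_def, h1] at hlt
    exact lt_irrefl _ hlt
  exact pos_iff_ne_zero.2 fun h0 =>
    hνpos (ProbabilityTheory.cond_absolutelyContinuous h0)

end Supercritical

end ERW

theorem mainTheorem1 :
    -- the walk with `k` extractions is an HLS urn with polynomial urn function
    (∀ (p : ℝ) (k : ℕ), 0 ≤ p → p ≤ 1 → Odd k →
      (∃ q : Polynomial ℝ, (∀ y, q.eval y = ERW.urnFunction p k y) ∧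
        (p ≠ 1 / 2 → q.natDegree = k)) ∧
      ∀ (M : ℕ) (xM : ℝ) (Ω : Type u) [MeasurableSpace Ω] (μ : Measure Ω)
        [IsProbabilityMeasure μ] (X : ℕ → Ω → ℝ), 1 ≤ M → ERW.IsERW p k M xM μ X →
        ERW.IsHLSUrn (ERW.urnFunction p k) M ((1 + xM) / 2) μ (fun n ω => (1 + X n ω) / 2)) ∧
    -- `k = 1`, and `k = 3` below the critical value
    (∀ (p : ℝ) (k : ℕ), 0 ≤ p → (k = 1 ∧ p < 1 ∨ k = 3 ∧ p < 5 / 6) →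
      {y ∈ Set.Icc (0 : ℝ) 1 | ERW.urnFunction p k y = y} = {1 / 2} ∧
      ERW.IsDownCrossing (ERW.urnFunction p k) (1 / 2) ∧
      ∀ (M : ℕ) (xM : ℝ) (Ω : Type u) [MeasurableSpace Ω] (μ : Measure Ω)
        [IsProbabilityMeasure μ] (X : ℕ → Ω → ℝ), 1 ≤ M → ERW.IsERW p k M xM μ X →
        ∀ᵐ ω ∂μ, ω ∈ ERW.limitEvent X 0) ∧
    -- `k = 3` above the critical value
    (∀ p : ℝ, 5 / 6 < p → p ≤ 1 →
      ERW.xMinus p < 0 ∧ 0 < ERW.xPlus p ∧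
      {y ∈ Set.Icc (0 : ℝ) 1 | ERW.urnFunction p 3 y = y} =
        {1 / 2, (1 + ERW.xMinus p) / 2, (1 + ERW.xPlus p) / 2} ∧
      ERW.IsUpCrossing (ERW.urnFunction p 3) (1 / 2) ∧
      ERW.IsDownCrossing (ERW.urnFunction p 3) ((1 + ERW.xMinus p) / 2) ∧
      ERW.IsDownCrossing (ERW.urnFunction p 3) ((1 + ERW.xPlus p) / 2) ∧
      -- almost sure convergence to one of the two attractors, for every initial condition;
      -- for `p < 1` both of them have positive probability
      (∀ (M : ℕ) (xM : ℝ) (Ω : Type u) [MeasurableSpace Ω] (μ : Measure Ω)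
        [IsProbabilityMeasure μ] (X : ℕ → Ω → ℝ), 1 ≤ M → ERW.IsERW p 3 M xM μ X →
        (∀ᵐ ω ∂μ, ω ∈ ERW.limitEvent X (ERW.xMinus p) ∨ ω ∈ ERW.limitEvent X (ERW.xPlus p)) ∧
        (p < 1 → 0 < μ (ERW.limitEvent X (ERW.xMinus p)) ∧
          0 < μ (ERW.limitEvent X (ERW.xPlus p)))) ∧
      -- dependence on the initial condition: the attractor farther from `x_M` is
      -- exponentially suppressed in `M`
      (∀ δ : ℝ, 0 < δ → ∃ c C : ℝ, 0 < c ∧ 0 < C ∧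
        ∀ (M : ℕ) (xM : ℝ) (Ω : Type u) [MeasurableSpace Ω] (μ : Measure Ω)
          [IsProbabilityMeasure μ] (X : ℕ → Ω → ℝ), 1 ≤ M → ERW.IsERW p 3 M xM μ X →
          (δ ≤ xM → μ.real (ERW.limitEvent X (ERW.xMinus p)) ≤ C * Real.exp (-c * M)) ∧
          (xM ≤ -δ → μ.real (ERW.limitEvent X (ERW.xPlus p)) ≤ C * Real.exp (-c * M)))) := by
  refine ⟨fun p k h0 h1 hk => ⟨ERW.exists_polynomial_eval_eq_urnFunction p hk,
    fun M xM Ω _ μ _ X hM hX => hX.isHLSUrn h0 h1 hk hM⟩,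
    fun p k h0 h => ERW.subcritical h0 h, fun p hp hp1 => ?_⟩
  have h0 : 0 ≤ p := by linarith
  have h3 : Odd 3 := by decide
  refine ⟨neg_neg_of_pos (ERW.xPlus_pos hp), ERW.xPlus_pos hp, ERW.fixedPoints_three hp hp1,
    ERW.isUpCrossing_three hp, ERW.isDownCrossing_three_xMinus hp,
    ERW.isDownCrossing_three_xPlus hp, ?_, ?_⟩
  · intro M xM Ω _ μ _ X hM hX
    have hS := hX.isStepProcess h0 hp1 h3 hM
    refine ⟨hS.ae_limit_three hp hp1, fun hp1' => ⟨?_, hS.measure_limitEvent_xPlus_pos hp hp1' hM⟩⟩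
    rw [← ERW.limitEvent_neg, ERW.xMinus_eq, neg_neg]
    exact (hS.neg (ERW.stepMean_three_neg p)).measure_limitEvent_xPlus_pos hp hp1' hM
  · intro δ hδ
    obtain ⟨c, hc, hbound⟩ := ERW.exists_rate_three.{u} hp hδ
    refine ⟨c, 1, hc, one_pos, fun M xM Ω _ μ _ X hM hX => ?_⟩
    have hS := hX.isStepProcess h0 hp1 h3 hM
    rw [one_mul]
    refine ⟨fun hx => hbound M Ω μ X hM hS ?_, fun hx => ?_⟩
    · filter_upwards [hX.initial] with ω hω
      rw [hω]
      exact hx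
    · rw [← ERW.limitEvent_neg, ← ERW.xMinus_eq]
      refine hbound M Ω μ _ hM (hS.neg (ERW.stepMean_three_neg p)) ?_
      filter_upwards [hX.initial] with ω hω
      rw [ERW.avg_neg, hω]
      linarith
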